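/- Let $p$ be a prime. All modules are over an algebraically closed field $F$ of characteristic $p$; $C_t$ is the cyclic group of order $t$. **Construction.** Let $S$ be a nonabelian finite simple group with $p \mid |S|$, identified with its group of inner automorphisms, and let $L$ be a subgroup of $\mathrm{Aut}(S)$ containing $S$ with $|L/S| = p$. Let $V$ be an irreducible faithful $FL$-module with $H^1(L,V)\neq 0$. For $t \ge 1$ let $G = L\wr C_t$ (with $C_t$ permuting the $t$ factors regularly), let $N = L_1\times\cdots\times L_t$ (with $L_i \cong L$) be its base group, let $X = V\otimes F\otimes\cdots\otimes F$ be the $FN$-module on which $L_1$ acts as on $V$ and $L_2,\dots,L_t$ act trivially, and let $M = M_t = X_N^G$ be the induced module. (A) For all such $F,S,L,V$: 1. for every $t\ge 1$, $M_t$ is an irreducible faithful $FG$-module and $\dim M_t = t\dim X$; 2. for every integer $k \ge 2$ there is a constant $d_k > 0$, independent of $t$, such that $\dim H^k(G,M_t) \ge d_k\, t^{k-2}\dim M_t$ for all sufficiently large $t$; 3. for every integer $k \ge 1$ there is a constant $e_k>0$, independent of $t$, such that $\dim H^k(G,M_t)\ge e_k(\dim M_t)^{k-1}$ for all sufficiently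 large $t$. (B) For every integer $k\ge1$ there is a constant $e = e(k,p)>0$, depending only on $k$ and $p$, such that for every algebraically closed field $F$ of characteristic $p$ there are $S$, $L$, $V$ as in the construction and positive integers $t_1,t_2,\dots$ such that, with $G_i = L\wr C_{t_i}$ and $M_i = M_{t_i}$ (irreducible faithful $FG_i$-modules), one has $\lim_{i\to\infty} \dim M_i = \infty$, $\dim H^k(G_i,M_i)\ge e(\dim M_i)^{k-1}$ for all $i$, and, if $k\ge 3$, both $$\lim_{i\to\infty}\frac{\dim H^k(G_i,M_i)}{\dim M_i}=\infty\qquad\text{and}\qquad \lim_{i\to\infty}\frac{\dim H^k(G_i,M_i)}{(\dim M_i)^{k-2}}=\infty.$$ (C) There is a constant $e_p>0$, depending only on $p$, such that for every algebraically closed field $F$ of characteristic $p$ and every positive integer $d$ there exist a finite group $G$ and an irreducible faithful $FG$-module $M$ with $\dim H^2(G,M)\ge e_p\dim M$ and $\dim M>d$. (D) If $k\ge3$ and $F$ is an algebraically closed field of characteristic $p$, there exist finite groups $G$ and irreducible faithful $FG$-modules $M$ with $\dim H^k(G,M)/(\dim M)^{k-2}$ arbitrarily large. -/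

import Mathlib

universe u

open Filter Topology

noncomputable section

/-- `S` is a nonabelian finite simple group of order divisible by `p`, and `L` is a subgroup of
`Aut(S)` which contains `S` (identified with its group of inner automorphisms) and satisfies
`|L / S| = p`. In particular `p` divides the order of the outer automorphism group of `S`. -/
structure IsExtensionByOuterAut (p : ℕ) (S : Type u) [Group S] (L : Subgroup (MulAut S)) :
    Prop where
  finite : Finite S
  simple : IsSimpleGroup S
  nonabelian : ∃ a b : S, a * b ≠ b * a
  dvd_card : p ∣ Nat.card S
  inn_le : (MulAut.conj : S →* MulAut S).range ≤ L
  index : (MulAut.conj : S →* MulAut S).range.relIndex L = p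

/-- The wreath product `L ≀ C_t` of `L` by the cyclic group of order `t` (for `t ≥ 1`), with `C_t`
permuting the `t` factors of the base group `L^t` regularly. -/
abbrev CyclicWreath (L : Type u) [Group L] (t : ℕ) : Type u :=
  RegularWreathProduct L (Multiplicative (ZMod t))

/-- The base group `N = L₁ × ⋯ × L_t` of `L ≀ C_t`. -/
abbrev CyclicWreath.base (L : Type u) [Group L] (t : ℕ) : Subgroup (CyclicWreath L t) :=
  (RegularWreathProduct.rightHom : CyclicWreath L t →* Multiplicative (ZMod t)).ker

/-- The projection of the base group `N = L₁ × ⋯ × L_t` onto its first factor `L₁`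
(the factor indexed by the identity element of `C_t`). -/
def CyclicWreath.projFirst (L : Type u) [Group L] (t : ℕ) : CyclicWreath.base L t →* L where
  toFun n := n.1.left 1
  map_one' := rfl
  map_mul' := by
    rintro ⟨a, ha⟩ ⟨b, hb⟩
    have h : a.right = 1 := ha
    simp [h]

/-- The `F N`-module `X = V ⊗ F ⊗ ⋯ ⊗ F`: the first factor `L₁` of `N` acts as on `V` and the other
factors act trivially. -/
abbrev CyclicWreath.outerModule {F L : Type u} [Field F] [Group L] (V : Rep.{u} F L) (t : ℕ) :
    Rep.{u} F (CyclicWreath.base L t) :=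
  Rep.res (CyclicWreath.projFirst L t) V

/-- The induced module `M = X_N^G` of `G = L ≀ C_t`. -/
abbrev CyclicWreath.inducedModule {F L : Type u} [Field F] [Group L] (V : Rep.{u} F L) (t : ℕ) :
    Rep.{u} F (CyclicWreath L t) :=
  Rep.ind (CyclicWreath.base L t).subtype (CyclicWreath.outerModule V t)

/-- The module is irreducible and the group acts faithfully on it. -/
structure IsIrreducibleFaithful {F G : Type u} [Field F] [Group G] (M : Rep.{u} F G) : Prop where
  irreducible : M.ρ.IsIrreducible
  faithful : Function.Injective M.ρ

/-- `dim_F M`. -/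
abbrev dimRep {F G : Type u} [Field F] [Group G] (M : Rep.{u} F G) : ℕ :=
  Module.finrank F M

/-- `dim_F H^k(G, M)`. -/
abbrev dimCoh {F G : Type u} [Field F] [Group G] (k : ℕ) (M : Rep.{u} F G) : ℕ :=
  Module.finrank F (groupCohomology M k)

end

/-! The lower bounds come from Shapiro's lemma and a fragment of the Künneth formula. The base group
has finite index, so `M` is also coinduced and `H^k(G, M) = H^k(L^t, X)`, where `X` is `V` inflated
from one factor. A nonzero class in `H^1(L, V)` can be multiplied by characters `L → L/S ≅ C_p → F`
of any `k - 1` of the other `t - 1` factors. These products are independent, so `dim H^k(G, M) ≥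
choose (t - 1) (k - 1)`, of order `t^(k - 1)`, while `dim M = t * dim V`.

Independence is obtained one factor at a time. For a split projection `N → G`, a character `χ` of
`N` trivial on the section and an element `x` of the kernel with `χ x = 1` commuting with the
section, `(a, b) ↦ infl a + χ ∪ infl b` is injective on `H^(n+1)(G, A) ⊕ H^n(G, A)`
(`coprod_injective`). The inverse is contraction with `x`, which anticommutes with the differential
(`contract_diff`). Iteration gives Pascal's rule.

Irreducibility of `M` holds because an element of a single factor isolates one coordinate of a
vector, and `C_t` permutes the coordinates transitively.

For existence, `S = SL_2(2^(p(p-1)))` has a field automorphism of order `p`. A faithful irreducible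
`V` with `H^1(L, V) ≠ 0` is extracted from a smallest module with an invariant functional that
vanishes on the `S`-invariants (`exists_irreducible_of_nonsplit`). As `S` and `L` depend only on
`p`, and `dim V ≤ |L|`, the constants are independent of `F`. -/

noncomputable section

/-! ### Contraction and face sums of inhomogeneous cochains -/

namespace GroupCochain

variable {F G X : Type*} [CommRing F] [AddCommGroup X] [Module F X]

/-- The alternating sum of the values of a cochain at the tuples obtained by inserting `x`. -/
def contract (x : G) : ∀ n : ℕ, ((Fin (n + 1) → G) → X) → (Fin n → G) → X
  | 0, f, _ => f ![x]
  | n + 1, f, v => f (Matrix.vecCons x v) -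
      contract x n (fun w => f (Matrix.vecCons (v 0) w)) fun i => v i.succ

theorem contract_cons (x : G) (n : ℕ) (f : (Fin (n + 2) → G) → X) (g : G) (v : Fin n → G) :
    contract x (n + 1) f (Matrix.vecCons g v) =
      f (Matrix.vecCons x (Matrix.vecCons g v)) -
        contract x n (fun w => f (Matrix.vecCons g w)) v := rfl

theorem contract_map {Y : Type*} [AddCommGroup Y] (φ : X →+ Y) (x : G) (n : ℕ)
    (f : (Fin (n + 1) → G) → X) (v : Fin n → G) :
    contract x n (fun w => φ (f w)) v = φ (contract x n f v) := by
  induction n with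
  | zero => simp [contract]
  | succ n ih => simp only [contract, map_sub, ← ih]

theorem contract_add (x : G) (n : ℕ) (f g : (Fin (n + 1) → G) → X) (v : Fin n → G) :
    contract x n (fun w => f w + g w) v = contract x n f v + contract x n g v := by
  induction n with
  | zero => simp [contract]
  | succ n ih => simp only [contract, ih]; abel

theorem contract_neg (x : G) (n : ℕ) (f : (Fin (n + 1) → G) → X) (v : Fin n → G) :
    contract x n (fun w => -f w) v = -contract x n f v :=
  contract_map (-AddMonoidHom.id X) x n f v

theorem contract_sub (x : G) (n : ℕ) (f g : (Fin (n + 1) → G) → X) (v : Fin n → G) :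
    contract x n (fun w => f w - g w) v = contract x n f v - contract x n g v := by
  simp only [sub_eq_add_neg, contract_add, contract_neg]

theorem contract_zero (x : G) (n : ℕ) (v : Fin n → G) : contract x n (fun _ => (0 : X)) v = 0 :=
  contract_map (0 : X →+ X) x n (fun _ => 0) v

variable [Mul G]

/-- The part of the differential of inhomogeneous cochains which does not involve the action on
the coefficients. -/
def faceSum : ∀ n : ℕ, ((Fin n → G) → X) → (Fin (n + 1) → G) → X
  | 0, f, _ => -f ![]
  | n + 1, f, v => -f (Matrix.vecCons (v 0 * v 1) fun i => v i.succ.succ) -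
      faceSum n (fun w => f (Matrix.vecCons (v 0) w)) fun i => v i.succ

theorem faceSum_cons_cons (n : ℕ) (f : (Fin (n + 1) → G) → X) (g h : G) (v : Fin n → G) :
    faceSum (n + 1) f (Matrix.vecCons g (Matrix.vecCons h v)) =
      -f (Matrix.vecCons (g * h) v) -
        faceSum n (fun w => f (Matrix.vecCons g w)) (Matrix.vecCons h v) := rfl

/-- Connects the usual alternating sum of faces with a recursion that peels off the first argument,
so that the later identities can be proved by induction on the degree. -/
theorem faceSum_eq (n : ℕ) (f : (Fin n → G) → X) (v : Fin (n + 1) → G) :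
    ∑ j : Fin (n + 1), (-1 : F) ^ ((j : ℕ) + 1) • f (Fin.contractNth j (· * ·) v) =
      faceSum n f v := by
  induction n with
  | zero =>
    simp only [faceSum]
    simp
    congr 1
    exact Subsingleton.elim _ _
  | succ n ih =>
    rw [Fin.sum_univ_succ, faceSum, ← ih, sub_eq_add_neg, ← Finset.sum_neg_distrib]
    congr 1
    · simp only [Fin.val_zero, zero_add, pow_one, neg_smul, one_smul]
      congr 2
      funext k
      refine Fin.cases ?_ (fun k => ?_) k
      · simp [Fin.contractNth]
      · simp [Fin.contractNth]
    · refine Finset.sum_congr rfl fun j _ => ?_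
      rw [Fin.val_succ, pow_succ _ ((j : ℕ) + 1), mul_neg_one, neg_smul]
      congr 3
      funext k
      refine Fin.cases ?_ (fun k => ?_) k
      · simp [Fin.contractNth]
      · simp [Fin.contractNth]

theorem faceSum_map {Y : Type*} [AddCommGroup Y] (φ : X →+ Y) (n : ℕ) (f : (Fin n → G) → X)
    (v : Fin (n + 1) → G) : faceSum n (fun w => φ (f w)) v = φ (faceSum n f v) := by
  induction n with
  | zero => simp [faceSum]
  | succ n ih => simp only [faceSum, map_sub, map_neg, ← ih]

theorem faceSum_sub (n : ℕ) (f g : (Fin n → G) → X) (v : Fin (n + 1) → G) :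
    faceSum n (fun w => f w - g w) v = faceSum n f v - faceSum n g v := by
  induction n with
  | zero => simp [faceSum]; abel
  | succ n ih => simp only [faceSum, ih]; abel

/-- When `x` is multiplied into its neighbour `h`, the insertions on the two sides of `h` give `x *
h` and `h * x` with opposite signs, and these cancel. The leftover `-f v` is the insertion of `x` in
the last slot followed by the face that drops the last entry. -/
theorem contract_faceSum (x : G) (n : ℕ) (f : (Fin (n + 1) → G) → X) (v : Fin (n + 1) → G)
    (hv : ∀ i, Commute x (v i)) :
    contract x (n + 1) (faceSum (n + 1) f) v = -faceSum n (contract x n f) v - f v := by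
  induction n with
  | zero =>
    obtain ⟨h, w, rfl⟩ : ∃ h w, v = Matrix.vecCons h w :=
      ⟨v 0, fun i => v i.succ, (Matrix.cons_head_tail v).symm⟩
    have hc : x * h = h * x := hv 0
    obtain rfl : w = ![] := Subsingleton.elim _ _
    rw [contract_cons, faceSum_cons_cons]
    have e : (fun i : Fin 0 => ![h, x] i.succ.succ) = ![] := Subsingleton.elim _ _
    simp only [contract, faceSum, hc, e]
    exact (fun a b c => by abel : ∀ a b c : X, -a - -b - (-a - -c) = - -b - c) _ _ _
  | succ n ih =>
    obtain ⟨h, w, rfl⟩ : ∃ h w, v = Matrix.vecCons h w :=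
      ⟨v 0, fun i => v i.succ, (Matrix.cons_head_tail v).symm⟩
    obtain ⟨h', w, rfl⟩ : ∃ h' u, w = Matrix.vecCons h' u :=
      ⟨w 0, fun i => w i.succ, (Matrix.cons_head_tail w).symm⟩
    have hc : x * h = h * x := hv 0
    have key : contract x (n + 1) (fun w => faceSum (n + 2) f (Matrix.vecCons h w))
        (Matrix.vecCons h' w) =
        -contract x (n + 1) (fun w => f (Matrix.vecCons (h * w 0) fun i => w i.succ))
          (Matrix.vecCons h' w) -
        contract x (n + 1) (faceSum (n + 1) (fun w => f (Matrix.vecCons h w)))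
          (Matrix.vecCons h' w) := by
      rw [← contract_neg, ← contract_sub]
      rfl
    rw [contract_cons, key, ih _ (Matrix.vecCons h' w) (fun i => hv i.succ)]
    rw [faceSum_cons_cons, faceSum_cons_cons, faceSum_cons_cons, contract_cons, contract_cons]
    simp only [contract_cons, faceSum_sub, Matrix.cons_val_zero, hc]
    have e : (fun i : Fin (n+1) => Matrix.vecCons x (Matrix.vecCons h' w) i.succ) =
      Matrix.vecCons h' w := rfl
    have e' : ∀ w : Fin (n + 1) → G, (fun i : Fin (n+1) => Matrix.vecCons h' w i.succ) = w :=
      fun _ => rfl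
    simp only [e, e']
    abel

theorem comap_faceSum {H : Type*} [Mul H] (π : G →ₙ* H) (n : ℕ) (f : (Fin n → H) → X)
    (v : Fin (n + 1) → G) :
    faceSum n (fun w => f fun i => π (w i)) v = faceSum n f fun i => π (v i) := by
  induction n with
  | zero => simp only [faceSum]; congr 2; exact Subsingleton.elim _ _
  | succ n ih =>
    have e : ∀ (m : ℕ) (g : G) (w : Fin m → G), (fun i => π (Matrix.vecCons g w i)) =
        Matrix.vecCons (π g) fun i => π (w i) := fun m g w => by
      funext i
      refine Fin.cases rfl (fun i => rfl) i
    simp only [faceSum, e, map_mul]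
    rw [ih (fun w => f (Matrix.vecCons (π (v 0)) w))]

end GroupCochain

/-! ### The differential, cup products with characters, and pullbacks -/

namespace GroupCochain

variable {F G : Type u} [CommRing F] [Group G] (A : Rep.{u} F G)

/-- The differential of inhomogeneous cochains as a linear map. -/
def diff (n : ℕ) : ((Fin n → G) → A) →ₗ[F] ((Fin (n + 1) → G) → A) :=
  (inhomogeneousCochains.d A n).hom

theorem diff_apply (n : ℕ) (f : (Fin n → G) → A) (v : Fin (n + 1) → G) :
    diff A n f v = A.ρ (v 0) (f fun i => v i.succ) + faceSum n f v := by
  rw [← faceSum_eq (F := F)]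
  exact inhomogeneousCochains.d_hom_apply A n f v

theorem diff_cons (n : ℕ) (f : (Fin n → G) → A) (g : G) (v : Fin n → G) :
    diff A n f (Matrix.vecCons g v) = A.ρ g (f v) + faceSum n f (Matrix.vecCons g v) :=
  diff_apply A n f _

/-- Contraction with an element which acts trivially and commutes with the arguments anticommutes
with the differential. -/
theorem contract_diff (x : G) (hx : ∀ a : A, A.ρ x a = a) (n : ℕ) (f : (Fin (n + 1) → G) → A)
    (v : Fin (n + 1) → G) (hv : ∀ i, Commute x (v i)) :
    contract x (n + 1) (diff A (n + 1) f) v = -diff A n (contract x n f) v := by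
  obtain ⟨g, w, rfl⟩ : ∃ g w, v = Matrix.vecCons g w :=
    ⟨v 0, fun i => v i.succ, (Matrix.cons_head_tail v).symm⟩
  have h1 : contract x (n + 1) (diff A (n + 1) f) (Matrix.vecCons g w) =
      contract x (n + 1) (fun u => A.ρ (u 0) (f fun i => u i.succ)) (Matrix.vecCons g w) +
        contract x (n + 1) (faceSum (n + 1) f) (Matrix.vecCons g w) := by
    rw [← contract_add]
    congr 1
    funext u
    exact diff_apply A _ f u
  -- Inserting `x` first makes the action term `f v`, since `x` acts trivially. It cancels the
  -- leftover `-f v` of `contract_faceSum`.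
  have h2 : contract x (n + 1) (fun u => A.ρ (u 0) (f fun i => u i.succ)) (Matrix.vecCons g w) =
      f (Matrix.vecCons g w) - A.ρ g (contract x n f w) := by
    rw [contract_cons]
    congr 1
    · exact hx _
    · exact contract_map (A.ρ g).toAddMonoidHom x n f w
  rw [h1, h2, contract_faceSum x n f _ hv, diff_cons]
  abel

/-- The cup product of an additive character with a cochain. -/
def cup (χ : G →* Multiplicative F) (n : ℕ) :
    ((Fin n → G) → A) →ₗ[F] ((Fin (n + 1) → G) → A) where
  toFun f v := (χ (v 0)).toAdd • A.ρ (v 0) (f fun i => v i.succ)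
  map_add' f g := by funext v; simp
  map_smul' c f := by funext v; simp [smul_comm c]

theorem cup_apply (χ : G →* Multiplicative F) (n : ℕ) (f : (Fin n → G) → A)
    (v : Fin (n + 1) → G) :
    cup A χ n f v = (χ (v 0)).toAdd • A.ρ (v 0) (f fun i => v i.succ) := rfl

/-- The Leibniz rule for a cocycle of degree one: additivity of `χ` on `g * h` removes the
differential of `χ`, and the sign comes from `χ` standing first. -/
theorem diff_cup (χ : G →* Multiplicative F) (n : ℕ) (f : (Fin n → G) → A) :
    diff A (n + 1) (cup A χ n f) = -cup A χ (n + 1) (diff A n f) := by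
  funext v
  obtain ⟨g, w, rfl⟩ : ∃ g w, v = Matrix.vecCons g w :=
    ⟨v 0, fun i => v i.succ, (Matrix.cons_head_tail v).symm⟩
  obtain ⟨h, w, rfl⟩ : ∃ h u, w = Matrix.vecCons h u :=
    ⟨w 0, fun i => w i.succ, (Matrix.cons_head_tail w).symm⟩
  have h1 : faceSum n (fun u => cup A χ n f (Matrix.vecCons g u)) (Matrix.vecCons h w) =
      (χ g).toAdd • A.ρ g (faceSum n f (Matrix.vecCons h w)) :=
    faceSum_map (((χ g).toAdd • A.ρ g : A →ₗ[F] A)).toAddMonoidHom n f _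
  have h2 : cup A χ n f (Matrix.vecCons (g * h) w) =
      ((χ g).toAdd + (χ h).toAdd) • A.ρ g (A.ρ h (f w)) := by
    rw [cup_apply]
    simp only [Matrix.cons_val_zero, map_mul, toAdd_mul, Module.End.mul_apply]
    rfl
  have h3 : cup A χ n f (Matrix.vecCons h w) = (χ h).toAdd • A.ρ h (f w) := rfl
  have h4 : cup A χ (n + 1) (diff A n f) (Matrix.vecCons g (Matrix.vecCons h w)) =
      (χ g).toAdd • A.ρ g (diff A n f (Matrix.vecCons h w)) := rfl
  rw [diff_cons, faceSum_cons_cons, h1, h2, h3, Pi.neg_apply, h4, diff_cons]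
  simp only [map_smul, map_add, smul_add, add_smul]
  abel

/-- The pullback of cochains along a group homomorphism `φ` and a linear map. -/
def pull {N : Type u} [Group N] {B : Rep.{u} F N} (φ : N →* G) (e : A →ₗ[F] B) (n : ℕ) :
    ((Fin n → G) → A) →ₗ[F] ((Fin n → N) → B) where
  toFun f v := e (f fun i => φ (v i))
  map_add' _ _ := by funext v; simp
  map_smul' _ _ := by funext v; simp

theorem pull_apply {N : Type u} [Group N] {B : Rep.{u} F N} (φ : N →* G) (e : A →ₗ[F] B) (n : ℕ)
    (f : (Fin n → G) → A) (v : Fin n → N) : pull A φ e n f v = e (f fun i => φ (v i)) := rfl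

theorem diff_pull {N : Type u} [Group N] {B : Rep.{u} F N} (φ : N →* G) (e : A →ₗ[F] B)
    (he : ∀ g a, e (A.ρ (φ g) a) = B.ρ g (e a)) (n : ℕ) (f : (Fin n → G) → A) :
    diff B n (pull A φ e n f) = pull A φ e (n + 1) (diff A n f) := by
  funext v
  have h1 : faceSum n (pull A φ e n f) v = e (faceSum n f fun i => φ (v i)) := by
    refine Eq.trans ?_ (congrArg e (comap_faceSum (φ : N →ₙ* G) n f v))
    exact faceSum_map e.toAddMonoidHom n (fun w => f fun i => φ (w i)) v
  rw [diff_apply, pull_apply, pull_apply, diff_apply, map_add, he, h1]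

end GroupCochain

/-! ### Cohomology in positive degree and split inflations -/

namespace GroupCochain

variable {F G : Type u} [Field F] [Group G] (A : Rep.{u} F G)

/-- The cohomology in degree `n + 1` as a quotient of the space of cocycles. -/
abbrev Coh (n : ℕ) : Type u :=
  LinearMap.ker (diff A (n + 1)) ⧸
    (LinearMap.range (diff A n)).submoduleOf (LinearMap.ker (diff A (n + 1)))

open CategoryTheory in
/-- Comparison with group cohomology as defined in Mathlib. -/
theorem nonempty_cohEquiv (n : ℕ) : Nonempty (groupCohomology A (n + 1) ≃ₗ[F] Coh A n) := by
  let K := groupCohomology.inhomogeneousCochains A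
  let S := K.sc' n (n + 1) (n + 2)
  let T : ShortComplex (ModuleCat F) :=
    ShortComplex.mk (inhomogeneousCochains.d A n) (inhomogeneousCochains.d A (n + 1))
      (groupCohomology.inhomogeneousCochains.d_comp_d n A)
  have hf : S.f = inhomogeneousCochains.d A n :=
    groupCohomology.inhomogeneousCochains.d_def A n
  have hg : S.g = inhomogeneousCochains.d A (n + 1) :=
    groupCohomology.inhomogeneousCochains.d_def A (n + 1)
  have e0 : S ≅ T := by
    refine ShortComplex.isoMk (Iso.refl _) (Iso.refl _) (Iso.refl _) ?_ ?_
    · exact (Category.id_comp _).trans (hf.symm.trans (Category.comp_id _).symm)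
    · exact (Category.id_comp _).trans (hg.symm.trans (Category.comp_id _).symm)
  have e1 : groupCohomology A (n + 1) ≅ T.moduleCatLeftHomologyData.H :=
    ShortComplex.homologyMapIso (K.isoSc' n (n + 1) (n + 2) (by simp) (by simp)) ≪≫
      ShortComplex.homologyMapIso e0 ≪≫ T.moduleCatHomologyIso
  refine ⟨e1.toLinearEquiv.trans (Submodule.quotEquivOfEq _ _ ?_)⟩
  ext ⟨x, hx⟩
  exact exists_congr fun y => Subtype.ext_iff

theorem finrank_groupCohomology (n : ℕ) : dimCoh (n + 1) A = Module.finrank F (Coh A n) :=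
  (nonempty_cohEquiv A n).some.finrank_eq

theorem coh_mk_eq_zero {n : ℕ} (f : LinearMap.ker (diff A (n + 1))) :
    (Submodule.Quotient.mk f : Coh A n) = 0 ↔ ∃ h, diff A n h = f := by
  rw [Submodule.Quotient.mk_eq_zero]
  exact Iff.rfl

instance [Finite G] [FiniteDimensional F A] (n : ℕ) : FiniteDimensional F (Coh A n) := by
  have : FiniteDimensional F ((Fin (n + 1) → G) → A) := inferInstance
  infer_instance

variable {A}

/-- The map on cohomology induced by a linear map of cochains. -/
def cohMap {N : Type u} [Group N] {B : Rep.{u} F N} {m n : ℕ}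
    (φ : ((Fin (m + 1) → G) → A) →ₗ[F] ((Fin (n + 1) → N) → B))
    (h₀ : ∀ f, ∃ f', diff B n f' = φ (diff A m f))
    (h₁ : ∀ f, diff A (m + 1) f = 0 → diff B (n + 1) (φ f) = 0) : Coh A m →ₗ[F] Coh B n :=
  Submodule.mapQ _ _
    (φ.restrict (p := LinearMap.ker (diff A (m + 1))) (q := LinearMap.ker (diff B (n + 1)))
      fun f hf => h₁ f hf) <| by
    rintro ⟨_, hx⟩ ⟨f, rfl⟩
    exact h₀ f

variable (A)

section

variable {N : Type u} [Group N] (π : N →* G)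

/-- The inflation map in cohomology. -/
def cohInfl (n : ℕ) : Coh A n →ₗ[F] Coh (Rep.res π A) n :=
  cohMap (pull A (B := Rep.res π A) π (LinearMap.id : A →ₗ[F] A) (n + 1))
    (fun f => ⟨pull A π LinearMap.id n f, diff_pull A π _ (fun _ _ => rfl) _ _⟩)
    (fun f hf => by rw [diff_pull A (B := Rep.res π A) π _ (fun _ _ => rfl), hf, map_zero])

/-- Inflation followed by the cup product with an additive character. -/
def cohInflCup (χ : N →* Multiplicative F) (n : ℕ) : Coh A n →ₗ[F] Coh (Rep.res π A) (n + 1) :=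
  cohMap (cup (Rep.res π A) χ (n + 1) ∘ₗ
      pull A (B := Rep.res π A) π (LinearMap.id : A →ₗ[F] A) (n + 1))
    (fun f => ⟨-cup (Rep.res π A) χ n (pull A (B := Rep.res π A) π (LinearMap.id : A →ₗ[F] A) n f),
      by rw [map_neg, diff_cup, neg_neg, diff_pull A (B := Rep.res π A) π _ (fun _ _ => rfl)]; rfl⟩)
    (fun f hf => by
      rw [LinearMap.comp_apply, diff_cup, diff_pull A (B := Rep.res π A) π _ (fun _ _ => rfl), hf,
        map_zero, map_zero, neg_zero])

variable {π} {ι : G →* N} (hι : ∀ g, π (ι g) = g)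
include hι

theorem pull_section (n : ℕ) (f : (Fin n → G) → A) :
    pull (Rep.res π A) (B := A) ι (LinearMap.id : A →ₗ[F] A) n
      (pull A (B := Rep.res π A) π (LinearMap.id : A →ₗ[F] A) n f) = f := by
  funext v
  simp [pull_apply, hι]

theorem diff_pull_section (n : ℕ) (f : (Fin n → N) → Rep.res π A) :
    diff A n (pull (Rep.res π A) (B := A) ι (LinearMap.id : A →ₗ[F] A) n f) =
      pull (Rep.res π A) (B := A) ι (LinearMap.id : A →ₗ[F] A) (n + 1) (diff (Rep.res π A) n f) :=
  diff_pull (Rep.res π A) (B := A) ι (LinearMap.id : A →ₗ[F] A)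
    (fun g a => by simp [hι]) n f

theorem cohInfl_injective (n : ℕ) : Function.Injective (cohInfl A π n) := by
  rw [injective_iff_map_eq_zero]
  intro a ha
  obtain ⟨⟨f, hf⟩, rfl⟩ := Submodule.Quotient.mk_surjective _ a
  obtain ⟨h, hh⟩ := (coh_mk_eq_zero _ _).1 ha
  refine (coh_mk_eq_zero _ _).2 ⟨pull (Rep.res π A) (B := A) ι (LinearMap.id : A →ₗ[F] A) n h, ?_⟩
  rw [diff_pull_section A hι, hh]
  exact pull_section A hι _ f

theorem finrank_coh_le_of_section [Finite N] [FiniteDimensional F A] (n : ℕ) :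
    Module.finrank F (Coh A n) ≤ Module.finrank F (Coh (Rep.res π A) n) :=
  have : FiniteDimensional F (Rep.res π A) := ‹FiniteDimensional F A›
  LinearMap.finrank_le_finrank_of_injective (cohInfl_injective A hι n)

/-- Inflation and cup products with a character `χ` are independent if there is an element `x`
which commutes with the image of the section and satisfies `χ x = 1`. -/
theorem coprod_injective {χ : N →* Multiplicative F} (hχ : ∀ g, χ (ι g) = 1) {x : N}
    (hx : π x = 1) (hχx : χ x = Multiplicative.ofAdd 1) (hc : ∀ g, Commute x (ι g)) (n : ℕ) :
    Function.Injective ((cohInfl A π (n + 1)).coprod (cohInflCup A π χ n)) := by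
  rw [injective_iff_map_eq_zero]
  rintro ⟨a, b⟩ hab
  obtain ⟨⟨f, hf⟩, rfl⟩ := Submodule.Quotient.mk_surjective _ a
  obtain ⟨⟨g, hg⟩, rfl⟩ := Submodule.Quotient.mk_surjective _ b
  set P := fun m => pull A (B := Rep.res π A) π (LinearMap.id : A →ₗ[F] A) m with hP
  set Q := fun m => pull (Rep.res π A) (B := A) ι (LinearMap.id : A →ₗ[F] A) m with hQ
  have hF : diff (Rep.res π A) (n + 2) (P (n + 2) f) = 0 := by
    rw [diff_pull A (B := Rep.res π A) π _ (fun _ _ => rfl)]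
    exact (congrArg _ hf).trans (map_zero _)
  have hG : diff (Rep.res π A) (n + 2) (cup (Rep.res π A) χ (n + 1) (P (n + 1) g)) = 0 := by
    rw [diff_cup, diff_pull A (B := Rep.res π A) π _ (fun _ _ => rfl), LinearMap.mem_ker.1 hg,
        map_zero, map_zero, neg_zero]
  obtain ⟨h, hh⟩ : ∃ h, diff (Rep.res π A) (n + 1) h =
      P (n + 2) f + cup (Rep.res π A) χ (n + 1) (P (n + 1) g) :=
    (coh_mk_eq_zero (Rep.res π A) ((⟨_, hF⟩ : LinearMap.ker (diff (Rep.res π A) (n + 2))) +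
      ⟨_, hG⟩)).1 <| by
    rw [LinearMap.coprod_apply] at hab
    rw [Submodule.Quotient.mk_add]
    exact hab
  -- Since `χ` is trivial on the section, restricting to it kills the cup product and leaves a
  -- primitive of `f`.
  have hf' : diff A (n + 1) (Q (n + 1) h) = f := by
    rw [diff_pull_section A hι, hh, map_add, pull_section A hι]
    have : pull (Rep.res π A) (B := A) ι (LinearMap.id : A →ₗ[F] A) (n + 2)
        (cup (Rep.res π A) χ (n + 1) (P (n + 1) g)) = 0 := by
      funext v
      rw [pull_apply, cup_apply, hχ]
      simp
    rw [this, add_zero]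
  -- Removing the inflated primitive of `f` leaves a primitive of the cup product alone.
  set k := h - P (n + 1) (Q (n + 1) h)
  have hk : diff (Rep.res π A) (n + 1) k = cup (Rep.res π A) χ (n + 1) (P (n + 1) g) := by
    rw [map_sub, hh, diff_pull A (B := Rep.res π A) π _ (fun _ _ => rfl), hf', add_sub_cancel_left]
  have hxa : ∀ a : Rep.res π A, (Rep.res π A).ρ x a = a := fun a => by
    simp [hx]
  -- Contracting `χ ∪ g` with `x` and restricting to the section returns `g`: only the insertion of
  -- `x` in the first slot survives, as otherwise `χ` is evaluated on the section.
  have hg' : diff A n (Q n (-contract x n k)) = g := by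
    rw [diff_pull_section A hι]
    funext v
    have h1 := contract_diff (Rep.res π A) x hxa n k (fun i => ι (v i)) (fun i => hc _)
    rw [hk] at h1
    rw [pull_apply, map_neg, Pi.neg_apply, ← h1]
    have h2 : contract x (n + 1) (cup (Rep.res π A) χ (n + 1) (P (n + 1) g)) (fun i => ι (v i)) =
        cup (Rep.res π A) χ (n + 1) (P (n + 1) g) (Matrix.vecCons x fun i => ι (v i)) -
        contract x n (fun w => cup (Rep.res π A) χ (n + 1) (P (n + 1) g)
          (Matrix.vecCons (ι (v 0)) w)) fun i => ι (v i.succ) := rfl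
    have h3 : (fun w => cup (Rep.res π A) χ (n + 1) (P (n + 1) g)
          (Matrix.vecCons (ι (v 0)) w)) = fun _ => 0 := by
      funext w
      rw [cup_apply, Matrix.cons_val_zero, hχ]
      simp
    rw [h2, h3, contract_zero, sub_zero, cup_apply, Matrix.cons_val_zero, hχx, hxa]
    simp [hP, pull_apply, hι]
  refine Prod.ext ((coh_mk_eq_zero _ _).2 ⟨_, hf'⟩) ((coh_mk_eq_zero _ _).2 ⟨_, hg'⟩)

theorem finrank_coh_add_le [Finite N] [FiniteDimensional F A] {χ : N →* Multiplicative F}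
    (hχ : ∀ g, χ (ι g) = 1) {x : N} (hx : π x = 1) (hχx : χ x = Multiplicative.ofAdd 1)
    (hc : ∀ g, Commute x (ι g)) (n : ℕ) :
    Module.finrank F (Coh A (n + 1)) + Module.finrank F (Coh A n) ≤
      Module.finrank F (Coh (Rep.res π A) (n + 1)) := by
  have : FiniteDimensional F (Rep.res π A) := ‹FiniteDimensional F A›
  have : Finite G := Finite.of_injective ι fun a b h => by rw [← hι a, h, hι]
  rw [← Module.finrank_prod]
  exact LinearMap.finrank_le_finrank_of_injective (coprod_injective A hι hχ hx hχx hc n)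

end

end GroupCochain

/-! ### Characters of order `p` and the cohomology of powers of `L` -/

theorem exists_character_of_index_eq {F G : Type*} [Field F] [Group G] (K : Subgroup G) [K.Normal]
    {p : ℕ} (hp : p.Prime) [CharP F p] (hK : K.index = p) :
    ∃ (χ : G →* Multiplicative F) (x : G), χ x = Multiplicative.ofAdd 1 := by
  have hcard : Nat.card (G ⧸ K) = p := hK
  subst hcard
  have : Fact (Nat.card (G ⧸ K)).Prime := ⟨hp⟩
  have hcyc : IsCyclic (G ⧸ K) := isCyclic_of_prime_card rfl
  let e := zmodCyclicMulEquiv hcyc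
  let c : ZMod (Nat.card (G ⧸ K)) →+ F := (ZMod.castHom (dvd_refl _) F).toAddMonoidHom
  obtain ⟨x, hx⟩ := QuotientGroup.mk'_surjective K (e (Multiplicative.ofAdd 1))
  refine ⟨(AddMonoidHom.toMultiplicative c).comp (e.symm.toMonoidHom.comp (QuotientGroup.mk' K)),
    x, ?_⟩
  change Multiplicative.ofAdd (c (e.symm (QuotientGroup.mk' K x)).toAdd) = _
  rw [hx]
  simp [c]

namespace GroupCochain

variable {F L : Type u} [Field F] [Group L] (V : Rep.{u} F L)

/-- The inflation of a module to a power of the group along the first projection. -/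
abbrev firstFactor (n : ℕ) : Rep.{u} F (Fin (n + 1) → L) :=
  Rep.res (Pi.evalMonoidHom (fun _ : Fin (n + 1) => L) 0) V

/-- The projection forgetting the last factor of a power of a group. -/
def initHom (L : Type*) [Group L] (n : ℕ) : (Fin (n + 2) → L) →* (Fin (n + 1) → L) where
  toFun f i := f i.castSucc
  map_one' := rfl
  map_mul' _ _ := rfl

/-- The inclusion of a power of a group with trivial last component. -/
def snocHom (L : Type*) [Group L] (n : ℕ) : (Fin (n + 1) → L) →* (Fin (n + 2) → L) where
  toFun f := Fin.snoc (α := fun _ => L) f 1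
  map_one' := by
    funext i
    refine Fin.lastCases ?_ (fun i => ?_) i <;> simp
  map_mul' f g := by
    funext i
    refine Fin.lastCases ?_ (fun i => ?_) i <;> simp

/-- Splitting off the last factor, with `χ` and `x` placed in that coordinate, turns
`finrank_coh_add_le` into Pascal's rule. `Coh _ k` has degree `k + 1`, so the induction starts from
`H^1(L, V) ≠ 0`. -/
theorem choose_le_finrank_coh_firstFactor [Finite L] [FiniteDimensional F V]
    (χ : L →* Multiplicative F) (x : L) (hx : χ x = Multiplicative.ofAdd 1)
    (hV : 1 ≤ Module.finrank F (Coh V 0)) (n k : ℕ) :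
    n.choose k ≤ Module.finrank F (Coh (firstFactor V n) k) := by
  have hfin : ∀ n, FiniteDimensional F (firstFactor V n) := fun n => ‹FiniteDimensional F V›
  have hsec : ∀ n f, initHom L n (snocHom L n f) = f := fun n f => by
    funext i
    simp [initHom, snocHom]
  have hres : ∀ n, Rep.res (initHom L n) (firstFactor V n) = firstFactor V (n + 1) :=
    fun n => rfl
  induction n generalizing k with
  | zero =>
    cases k with
    | zero =>
      refine hV.trans ?_
      let ι : L →* (Fin 1 → L) := MonoidHom.pi fun _ => MonoidHom.id L
      exact finrank_coh_le_of_section V (ι := ι) (fun g => rfl) 0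
    | succ k => simp
  | succ n ih =>
    cases k with
    | zero =>
      refine (by simpa using ih 0 : 1 ≤ _).trans ?_
      rw [← hres]
      exact finrank_coh_le_of_section (firstFactor V n) (hsec n) 0
    | succ k =>
      rw [Nat.choose_succ_succ, add_comm]
      refine (add_le_add (ih _) (ih _)).trans ?_
      rw [← hres]
      refine finrank_coh_add_le (firstFactor V n) (hsec n)
        (χ := χ.comp (Pi.evalMonoidHom (fun _ => L) (Fin.last (n + 1))))
        (fun g => by simp [snocHom]) (x := Pi.mulSingle (Fin.last (n + 1)) x) ?_ (by simpa) ?_ k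
      · funext i
        simp [initHom, Fin.castSucc_ne_last]
      · intro g
        funext i
        refine Fin.lastCases ?_ (fun i => ?_) i <;> simp [snocHom]

end GroupCochain

/-! ### Shapiro's lemma for the wreath product -/

namespace CyclicWreath

open GroupCochain

/-- The base group of the wreath product as a power of the group. -/
def toPi (L : Type u) [Group L] (n : ℕ) : base L (n + 1) →* (Fin (n + 1) → L) where
  toFun g i := g.1.left (Multiplicative.ofAdd (i : ZMod (n + 1)))
  map_one' := rfl
  map_mul' := by
    rintro ⟨a, ha⟩ ⟨b, hb⟩
    have h : a.right = 1 := ha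
    funext i
    simp [h]

/-- The inverse of `CyclicWreath.toPi`. -/
def ofPi (L : Type u) [Group L] (n : ℕ) : (Fin (n + 1) → L) →* base L (n + 1) where
  toFun f := ⟨⟨fun c => f (Multiplicative.toAdd c : ZMod (n + 1)), 1⟩, rfl⟩
  map_one' := rfl
  map_mul' f g := by
    refine Subtype.ext (RegularWreathProduct.ext ?_ ?_)
    · funext c
      simp
      rfl
    · simp

instance (L : Type u) [Group L] [Finite L] (t : ℕ) [NeZero t] : Finite (CyclicWreath L t) := by
  have : Finite (Multiplicative (ZMod t)) := inferInstanceAs (Finite (ZMod t))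
  infer_instance

variable {F L : Type u} [Field F] [Group L] (V : Rep.{u} F L)

/-- Induction and coinduction agree for the base group, and Shapiro's lemma applies to the coinduced
module. -/
theorem dimCoh_inducedModule [Finite L] (t : ℕ) [NeZero t] (k : ℕ) :
    dimCoh k (inducedModule V t) = dimCoh k (outerModule V t) := by
  classical
  exact ((groupCohomology.functor F (CyclicWreath L t) k).mapIso
    (Rep.indCoindIso (outerModule V t)) ≪≫
      groupCohomology.coindIso (outerModule V t) k).toLinearEquiv.finrank_eq

theorem choose_le_dimCoh [Finite L] [FiniteDimensional F V] (χ : L →* Multiplicative F) (x : L)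
    (hx : χ x = Multiplicative.ofAdd 1) [Nontrivial (groupCohomology V 1)] (n k : ℕ) :
    n.choose k ≤ dimCoh (k + 1) (inducedModule V (n + 1)) := by
  have hV : 1 ≤ Module.finrank F (Coh V 0) := by
    have := (nonempty_cohEquiv V 0).some.symm.toEquiv.nontrivial
    exact Module.finrank_pos
  rw [dimCoh_inducedModule, finrank_groupCohomology]
  refine (choose_le_finrank_coh_firstFactor V χ x hx hV n k).trans ?_
  have : FiniteDimensional F (firstFactor V n) := ‹FiniteDimensional F V›
  -- Only a lower bound is needed, so a right inverse of `toPi` suffices and no isomorphism of the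
  -- base group with `L^t` has to be transported.
  exact finrank_coh_le_of_section (firstFactor V n) (π := toPi L n) (ι := ofPi L n)
    (fun g => rfl) k

end CyclicWreath

/-! ### Irreducible and faithful representations -/

theorem Representation.isIrreducible_iff_forall_submodule {k G V : Type*} [Field k] [Monoid G]
    [AddCommGroup V] [Module k V] (ρ : Representation k G V) :
    ρ.IsIrreducible ↔ Nontrivial V ∧
      ∀ W : Submodule k V, (∀ g, ∀ v ∈ W, ρ g v ∈ W) → W = ⊥ ∨ W = ⊤ := by
  have htop : (⊤ : Subrepresentation ρ).toSubmodule = ⊤ := rfl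
  have hbot : (⊥ : Subrepresentation ρ).toSubmodule = ⊥ := rfl
  constructor
  · intro h
    refine ⟨?_, fun W hW => ?_⟩
    · by_contra hV
      rw [not_nontrivial_iff_subsingleton] at hV
      refine bot_ne_top (α := Subrepresentation ρ)
        (Subrepresentation.toSubmodule_injective (Subsingleton.elim _ _))
    · refine (eq_bot_or_eq_top (⟨W, fun g v hv => hW g v hv⟩ : Subrepresentation ρ)).imp ?_ ?_
      · exact fun h => (congrArg Subrepresentation.toSubmodule h).trans hbot
      · exact fun h => (congrArg Subrepresentation.toSubmodule h).trans htop
  · rintro ⟨hV, h⟩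
    have : Nontrivial (Subrepresentation ρ) := ⟨⊥, ⊤, fun e =>
      bot_ne_top (α := Submodule k V) (congrArg Subrepresentation.toSubmodule e)⟩
    refine ⟨fun W => ?_⟩
    refine (h W.toSubmodule fun g v hv => W.apply_mem_toSubmodule g hv).imp ?_ ?_
    · exact fun h => Subrepresentation.toSubmodule_injective (h.trans hbot.symm)
    · exact fun h => Subrepresentation.toSubmodule_injective (h.trans htop.symm)

section

variable {F G : Type u} [Field F] [Group G]

theorem Representation.IsIrreducible.span_orbit_eq_top {V : Type*} [AddCommGroup V] [Module F V]
    {ρ : Representation F G V} (h : ρ.IsIrreducible) {v : V} (hv : v ≠ 0) :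
    Submodule.span F (Set.range fun g => ρ g v) = ⊤ := by
  rw [Representation.isIrreducible_iff_forall_submodule] at h
  refine (h.2 _ fun g w hw => ?_).resolve_left fun h0 => hv ?_
  · have hle : Submodule.span F (Set.range fun g => ρ g v) ≤
        (Submodule.span F (Set.range fun g => ρ g v)).comap (ρ g) := by
      rw [Submodule.span_le]
      rintro _ ⟨g', rfl⟩
      exact Submodule.subset_span ⟨g * g', by simp⟩
    exact hle hw
  · have : v ∈ Submodule.span F (Set.range fun g => ρ g v) :=
      Submodule.subset_span ⟨1, by simp⟩
    rwa [h0, Submodule.mem_bot] at this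

/-- The orbit of a nonzero vector spans. The bound by the group order does not involve the field,
which later makes the constants uniform in `F`. -/
theorem Representation.IsIrreducible.finite_and_finrank_le [Finite G] {V : Type*} [AddCommGroup V]
    [Module F V] {ρ : Representation F G V} (h : ρ.IsIrreducible) :
    FiniteDimensional F V ∧ Module.finrank F V ≤ Nat.card G := by
  have := ((Representation.isIrreducible_iff_forall_submodule ρ).1 h).1
  obtain ⟨v, hv⟩ := exists_ne (0 : V)
  have htop := h.span_orbit_eq_top hv
  have hf : (Set.range fun g => ρ g v).Finite := Set.finite_range _
  refine ⟨⟨htop ▸ Submodule.fg_span hf⟩, ?_⟩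
  have : Fintype G := Fintype.ofFinite G
  rw [← finrank_top, ← htop, Nat.card_eq_fintype_card]
  exact finrank_range_le_card _

theorem IsIrreducibleFaithful.finiteDimensional [Finite G] {M : Rep.{u} F G}
    (h : IsIrreducibleFaithful M) : FiniteDimensional F M :=
  h.irreducible.finite_and_finrank_le.1

theorem IsIrreducibleFaithful.dimRep_le [Finite G] {M : Rep.{u} F G}
    (h : IsIrreducibleFaithful M) : dimRep M ≤ Nat.card G :=
  h.irreducible.finite_and_finrank_le.2

theorem IsIrreducibleFaithful.nontrivial {M : Rep.{u} F G} (h : IsIrreducibleFaithful M) :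
    Nontrivial M :=
  ((Representation.isIrreducible_iff_forall_submodule _).1 h.irreducible).1

/-- The orbit of a fixed nonzero vector spans the module, so the group would act trivially. -/
theorem IsIrreducibleFaithful.exists_apply_ne [Nontrivial G] {M : Rep.{u} F G}
    (h : IsIrreducibleFaithful M) {v : M} (hv : v ≠ 0) : ∃ g, M.ρ g v ≠ v := by
  by_contra! hfix
  obtain ⟨g, hg⟩ := exists_ne (1 : G)
  refine hg (h.faithful (LinearMap.ext fun w => ?_))
  rw [map_one, Module.End.one_apply]
  have hw : w ∈ Submodule.span F (Set.range fun g => M.ρ g v) := by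
    rw [h.irreducible.span_orbit_eq_top hv]
    trivial
  have hle : Submodule.span F (Set.range fun g => M.ρ g v) ≤
      LinearMap.eqLocus (M.ρ g) LinearMap.id := by
    rw [Submodule.span_le]
    rintro _ ⟨g', rfl⟩
    simp [hfix]
  exact hle hw

open CategoryTheory in
theorem IsIrreducibleFaithful.of_iso {M M' : Rep.{u} F G} (e : M ≅ M')
    (h : IsIrreducibleFaithful M) : IsIrreducibleFaithful M' := by
  obtain ⟨h1, h2⟩ := (Representation.isIrreducible_iff_forall_submodule _).1 h.irreducible
  have hinj : Function.Injective e.hom.hom :=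
    Function.LeftInverse.injective (g := e.inv.hom) (Rep.inv_hom_apply _ _ e)
  have hsurj : Function.Surjective e.hom.hom :=
    Function.RightInverse.surjective (g := e.inv.hom) (Rep.hom_inv_apply _ _ e)
  refine ⟨(Representation.isIrreducible_iff_forall_submodule _).2 ⟨hinj.nontrivial,
    fun W hW => ?_⟩, fun g g' hg => h.faithful (LinearMap.ext fun v => hinj ?_)⟩
  · refine (h2 (W.comap e.hom.hom.toLinearMap) fun g v hv => ?_).imp (fun h => ?_) fun h => ?_
    · have := hW g _ hv
      change e.hom.hom (M.ρ g v) ∈ W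
      rw [Rep.hom_comm_apply]
      exact this
    · refine (Submodule.eq_bot_iff _).2 fun w hw => ?_
      obtain ⟨v, rfl⟩ := hsurj w
      have hv : v ∈ W.comap e.hom.hom.toLinearMap := hw
      rw [h, Submodule.mem_bot] at hv
      rw [hv, map_zero]
    · refine Submodule.eq_top_iff'.2 fun w => ?_
      obtain ⟨v, rfl⟩ := hsurj w
      have hv : v ∈ W.comap e.hom.hom.toLinearMap := h ▸ Submodule.mem_top
      exact hv
  · rw [Rep.hom_comm_apply, Rep.hom_comm_apply, hg]

open CategoryTheory in
theorem dimRep_eq_of_iso {M M' : Rep.{u} F G} (e : M ≅ M') : dimRep M = dimRep M' :=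
  ((forget₂ (Rep F G) (ModuleCat F)).mapIso e).toLinearEquiv.finrank_eq

end

/-! ### Irreducibility, faithfulness and dimension of the induced module -/

namespace CyclicWreath

variable {F L : Type u} [Field F] [Group L] (V : Rep.{u} F L) (t : ℕ)

/-- The induced module in coordinates: the wreath product acts on a direct sum of copies of `V`. -/
def powerRep : Representation F (CyclicWreath L t) (Multiplicative (ZMod t) → V) where
  toFun h :=
    { toFun φ c := V.ρ (h.left c⁻¹) (φ (c * h.right))
      map_add' _ _ := by funext c; simp
      map_smul' _ _ := by funext c; simp }
  map_one' := by ext; simp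
  map_mul' g h := by
    refine LinearMap.ext fun φ => funext fun c => ?_
    simp [mul_assoc]

theorem powerRep_apply (h : CyclicWreath L t) (φ : Multiplicative (ZMod t) → V)
    (c : Multiplicative (ZMod t)) :
    powerRep V t h φ c = V.ρ (h.left c⁻¹) (φ (c * h.right)) := rfl

/-- The functions in the coinduced module are determined by their values on the top group. -/
def coindEquiv : (Representation.coindV (base L t).subtype (outerModule V t).ρ) ≃ₗ[F]
    (Multiplicative (ZMod t) → V) where
  toFun f c := f.1 (RegularWreathProduct.inl c)
  map_add' _ _ := rfl
  map_smul' _ _ := rfl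
  invFun φ := ⟨fun g => V.ρ (g.left 1) (φ g.right), by
    rintro ⟨n, hn⟩ g
    have hn' : n.right = 1 := hn
    simp [hn', projFirst]⟩
  left_inv := by
    rintro ⟨f, hf⟩
    refine Subtype.ext (funext fun g => ?_)
    have := hf ⟨⟨g.left, 1⟩, rfl⟩ (RegularWreathProduct.inl g.right)
    have hg : (⟨g.left, 1⟩ : CyclicWreath L t) * RegularWreathProduct.inl g.right = g := by
      ext <;> simp
    change f (⟨g.left, 1⟩ * _) = _ at this
    rw [hg] at this
    exact this.symm
  right_inv φ := by
    funext c
    simp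

/-- The induced module in coordinates. -/
def inducedIso [NeZero t] : inducedModule V t ≅ Rep.of (powerRep V t) := by
  classical
  have : (base L t).FiniteIndex := by
    have : Finite (Multiplicative (ZMod t)) := inferInstanceAs (Finite (ZMod t))
    infer_instance
  refine Rep.indCoindIso (outerModule V t) ≪≫ Rep.mkIso (.mk (coindEquiv V t) fun g => ?_)
  refine LinearMap.ext fun f => funext fun c => ?_
  -- `inl c * g` is rewritten as a base element times `inl (c * g.right)`. The base element acts on
  -- `V` through its coordinate at `1`, which is `g.left c⁻¹`.
  have h := f.2 ⟨⟨fun x => g.left (c⁻¹ * x), 1⟩, rfl⟩ (RegularWreathProduct.inl (c * g.right))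
  have hg : (⟨fun x => g.left (c⁻¹ * x), 1⟩ : CyclicWreath L t) *
      RegularWreathProduct.inl (c * g.right) = RegularWreathProduct.inl c * g := by
    ext <;> simp
  change f.1 (⟨fun x => g.left (c⁻¹ * x), 1⟩ * _) = _ at h
  rw [hg] at h
  refine h.trans ?_
  change V.ρ (g.left (c⁻¹ * 1)) _ = V.ρ (g.left c⁻¹) _
  rw [mul_one]
  rfl

theorem dimRep_inducedModule [NeZero t] :
    dimRep (inducedModule V t) = t * dimRep (outerModule V t) := by
  rw [dimRep_eq_of_iso (inducedIso V t)]
  have : Fintype (Multiplicative (ZMod t)) := inferInstanceAs (Fintype (ZMod t))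
  change Module.finrank F (Multiplicative (ZMod t) → V) = t * Module.finrank F V
  by_cases hV : FiniteDimensional F V
  · rw [Module.finrank_pi_fintype]
    simp only [Finset.sum_const, Finset.card_univ, smul_eq_mul]
    congr 1
    rw [← Nat.card_eq_fintype_card]
    exact Nat.card_zmod t
  -- For infinite-dimensional `V` both sides are the default value `0`.
  · rw [Module.finrank_of_infinite_dimensional hV, mul_zero,
      Module.finrank_of_infinite_dimensional]
    intro h
    exact hV (Module.Finite.of_surjective (LinearMap.proj (φ := fun _ => V) (1 : Multiplicative (ZMod t)))
      (Function.surjective_eval (β := fun _ => V) (1 : Multiplicative (ZMod t))))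

theorem powerRep_single [DecidableEq (Multiplicative (ZMod t))] (l : L)
    (c : Multiplicative (ZMod t)) (φ : Multiplicative (ZMod t) → V) :
    powerRep V t ⟨Pi.mulSingle c⁻¹ l, 1⟩ φ = φ + Pi.single c (V.ρ l (φ c) - φ c) := by
  funext d
  rw [powerRep_apply]
  by_cases h : d = c
  · subst h
    simp
  · have : d⁻¹ ≠ c⁻¹ := fun e => h (inv_injective e)
    simp [h]

/-- Take a nonzero `φ` in an invariant subspace. An element of one factor that moves `φ c` changes
only the coordinate `c`, so the difference is a nonzero vector supported at `c`. Irreducibility of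
`V` fills this coordinate and the top group carries it to all others. For faithfulness, vectors
supported at one coordinate detect the top component and constant functions detect the base. -/
theorem isIrreducibleFaithful_powerRep [Nontrivial L] [NeZero t] (hV : IsIrreducibleFaithful V) :
    IsIrreducibleFaithful (Rep.of (powerRep V t)) := by
  classical
  have hfin : Finite (Multiplicative (ZMod t)) := inferInstanceAs (Finite (ZMod t))
  have : Fintype (Multiplicative (ZMod t)) := Fintype.ofFinite _
  have hnt := hV.nontrivial
  obtain ⟨h1, h2⟩ := (Representation.isIrreducible_iff_forall_submodule _).1 hV.irreducible
  refine ⟨(Representation.isIrreducible_iff_forall_submodule (powerRep V t)).2 ⟨?_, ?_⟩, ?_⟩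
  · infer_instance
  · intro W hW
    refine or_iff_not_imp_left.2 fun hW0 => ?_
    obtain ⟨φ, hφ, hφ0⟩ := W.ne_bot_iff.1 hW0
    obtain ⟨c, hc⟩ := Function.ne_iff.1 hφ0
    obtain ⟨l, hl⟩ := hV.exists_apply_ne hc
    have hsingle : ∀ d, W.comap (LinearMap.single F (fun _ => V) d) =
        ⊥ ∨ W.comap (LinearMap.single F (fun _ => V) d) = ⊤ := by
      refine fun d => h2 _ fun l v hv => ?_
      have := hW ⟨Pi.mulSingle d⁻¹ l, 1⟩ _ hv
      rw [powerRep_single] at this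
      simpa [Pi.single_sub] using this
    have hctop : W.comap (LinearMap.single F (fun _ => V) c) = ⊤ := by
      refine (hsingle c).resolve_left fun h0 => hl ?_
      have hmem : V.ρ l (φ c) - φ c ∈ W.comap (LinearMap.single F (fun _ => V) c) := by
        have := W.sub_mem (hW ⟨Pi.mulSingle c⁻¹ l, 1⟩ _ hφ) hφ
        rwa [powerRep_single, add_sub_cancel_left] at this
      rw [h0, Submodule.mem_bot] at hmem
      exact sub_eq_zero.1 hmem
    have hall : ∀ d v, Pi.single d v ∈ W := by
      intro d v
      have hv : v ∈ W.comap (LinearMap.single F (fun _ => V) c) := hctop ▸ Submodule.mem_top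
      have := hW (RegularWreathProduct.inl (d⁻¹ * c)) _ hv
      convert this using 1
      funext x
      rw [powerRep_apply]
      by_cases hx : x = d
      · subst hx
        simp
      · have : x * (d⁻¹ * c) ≠ c := fun e => hx (by
          rw [← mul_assoc, mul_eq_right, mul_inv_eq_one] at e; exact e)
        simp [hx, this]
    refine Submodule.eq_top_iff'.2 fun ψ => ?_
    rw [← Finset.univ_sum_single ψ]
    exact W.sum_mem fun d _ => hall d _
  · rw [injective_iff_map_eq_one]
    intro h hh
    have hh' : ∀ (φ : Multiplicative (ZMod t) → V) c, V.ρ (h.left c⁻¹) (φ (c * h.right)) = φ c := fun φ c =>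
      congrFun (LinearMap.congr_fun hh φ) c
    obtain ⟨v, hv⟩ := exists_ne (0 : V)
    have hr : h.right = 1 := by
      by_contra hne
      have h3 := hh' (Pi.single 1 v) 1
      rw [one_mul, Pi.single_eq_of_ne hne, map_zero, Pi.single_eq_same] at h3
      exact hv h3.symm
    refine RegularWreathProduct.ext (funext fun c => hV.faithful (LinearMap.ext fun w => ?_)) hr
    have h3 := hh' (fun _ => w) c⁻¹
    rw [inv_inv] at h3
    simpa using h3

theorem isIrreducibleFaithful_inducedModule [Nontrivial L] [NeZero t]
    (hV : IsIrreducibleFaithful V) : IsIrreducibleFaithful (inducedModule V t) :=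
  (isIrreducibleFaithful_powerRep V t hV).of_iso (inducedIso V t).symm

end CyclicWreath

/-! ### Irreducible modules with nonzero first cohomology -/

namespace GroupCochain

/-- A crossed homomorphism which is not principal gives a nonzero class in the first cohomology. -/
theorem nontrivial_groupCohomology_one {F G : Type u} [Field F] [Group G] (A : Rep.{u} F G)
    (c : G → A) (hc : ∀ g h, c (g * h) = A.ρ g (c h) + c g)
    (hne : ∀ a : A, ¬ ∀ g, c g = A.ρ g a - a) : Nontrivial (groupCohomology A 1) := by
  have hz : diff A 1 (fun v => c (v 0)) = 0 := by
    funext v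
    rw [diff_apply]
    simp only [faceSum, Matrix.cons_val_zero, hc]
    change A.ρ (v 0) (c (v 1)) + (-(A.ρ (v 0) (c (v 1)) + c (v 0)) - -c (v 0)) = 0
    abel
  have : Nontrivial (Coh A 0) := by
    refine ⟨Submodule.Quotient.mk ⟨_, hz⟩, 0, fun h => ?_⟩
    obtain ⟨f, hf⟩ := (coh_mk_eq_zero _ _).1 h
    refine hne (f ![]) fun g => ?_
    have h1 := congrFun hf ![g]
    rw [diff_cons] at h1
    simp only [faceSum, Matrix.cons_val_zero] at h1
    rw [← h1, sub_eq_add_neg]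
  exact (nonempty_cohEquiv A 0).some.toEquiv.nontrivial

end GroupCochain

section

variable {F G : Type u} [Field F] [Group G]

/-- A finite-dimensional module with an invariant nonzero functional which vanishes on the
invariants of the subgroup `K`. -/
structure HasNonsplitFunctional (K : Subgroup G) (U : Rep.{u} F G) (π : U →ₗ[F] F) : Prop where
  finite : FiniteDimensional F U
  invariant : ∀ g u, π (U.ρ g u) = π u
  ne_zero : π ≠ 0
  vanish : ∀ u, (∀ k ∈ K, U.ρ k u = u) → π u = 0

/-- In the regular module with the sum of values as functional, a `K`-invariant function is constant
on left cosets of `K`, so its sum is a multiple of `|K| = 0` in `F`. -/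
theorem exists_hasNonsplitFunctional [Finite G] (K : Subgroup G) {p : ℕ} [CharP F p]
    (hp : p ∣ Nat.card K) :
    ∃ (U : Rep.{u} F G) (π : U →ₗ[F] F), HasNonsplitFunctional K U π := by
  classical
  have : Fintype G := Fintype.ofFinite G
  let ρ : Representation F G (G → F) :=
    { toFun g := LinearMap.funLeft F F (· * g)
      map_one' := by ext; simp
      map_mul' g h := by
        refine LinearMap.ext fun f => funext fun x => ?_
        simp [mul_assoc] }
  have hρ : ∀ g f x, ρ g f x = f (x * g) := fun g f x => rfl
  let π : (G → F) →ₗ[F] F := ∑ x, LinearMap.proj x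
  have hπ : ∀ f, π f = ∑ x, f x := fun f => by simp [π]
  refine ⟨Rep.of ρ, π, ⟨inferInstanceAs (FiniteDimensional F (G → F)), ?_, ?_, ?_⟩⟩
  · intro g f
    change π (ρ g f) = π f
    rw [hπ, hπ]
    exact Fintype.sum_equiv (Equiv.mulRight g) _ _ fun x => rfl
  · intro h
    have := LinearMap.congr_fun h (Pi.single 1 1)
    rw [hπ] at this
    simp at this
  · intro f hf
    change π f = 0
    have hfix : ∀ k ∈ K, ∀ x, f (x * k) = f x := fun k hk x => congrFun (hf k hk) x
    have : Fintype (G ⧸ K) := Fintype.ofFinite _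
    have hbij : Function.Bijective fun q : (G ⧸ K) × K => q.1.out * (q.2 : G) := by
      refine ⟨fun q r h => ?_, fun x => ?_⟩
      · have h1 : q.1 = r.1 := by
          have := congrArg (QuotientGroup.mk (s := K)) h
          simpa using this
        refine Prod.ext h1 (Subtype.ext ?_)
        simp only [h1] at h
        exact mul_left_cancel h
      · obtain ⟨k, hk⟩ := QuotientGroup.mk_out_eq_mul K x
        exact ⟨(QuotientGroup.mk x, k⁻¹), by simp [hk]⟩
    rw [hπ, ← Equiv.sum_comp (Equiv.ofBijective _ hbij), Fintype.sum_prod_type]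
    refine Finset.sum_eq_zero fun q _ => ?_
    have : ∀ k : K, f (Equiv.ofBijective _ hbij (q, k)) = f q.out := fun k => hfix k k.2 _
    simp only [this, Finset.sum_const, Finset.card_univ, nsmul_eq_mul]
    rw [← Nat.card_eq_fintype_card, (CharP.cast_eq_zero_iff F p _).2 hp, zero_mul]

/-- Choose `U` of least dimension with such a functional `π`, a minimal nonzero submodule `V` of
`ker π`, and let `T` be the `K`-invariants. Minimality against `U / V`, then against the submodule
of vectors that are `K`-fixed modulo `V`, shows that `K` acts trivially on `U / V`. As `K` has no
nonzero additive characters, `V` is not inside `T`, hence `V ∩ T = 0`. The group `G / K` of order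
`p` fixes a nonzero vector of `U / (V ⊕ T)`, and the `V`-component of `g u - u` for a lift `u` is a
nonprincipal crossed homomorphism. -/
theorem exists_irreducible_of_nonsplit [Finite G] (K : Subgroup G) [K.Normal] {p : ℕ}
    (hp : p.Prime) [CharP F p] (hindex : K.index = p) (hdvd : p ∣ Nat.card K)
    (hperf : ∀ (T : Type u) [AddCommGroup T] (f : K → T),
      (∀ a b, f (a * b) = f a + f b) → ∀ a, f a = 0) :
    ∃ V : Rep.{u} F G, V.ρ.IsIrreducible ∧ (∃ k ∈ K, V.ρ k ≠ 1) ∧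
      Nontrivial (groupCohomology V 1) := by
  classical
  have hex : ∃ (n : ℕ) (U : Rep.{u} F G) (π : U →ₗ[F] F),
      HasNonsplitFunctional K U π ∧ dimRep U = n := by
    obtain ⟨U, π, h⟩ := exists_hasNonsplitFunctional (F := F) K hdvd
    exact ⟨_, U, π, h, rfl⟩
  obtain ⟨U, π, hU, hdim⟩ := Nat.find_spec hex
  have hmin : ∀ (U' : Rep.{u} F G) (π' : U' →ₗ[F] F), HasNonsplitFunctional K U' π' →
      dimRep U ≤ dimRep U' := fun U' π' h => by
    rw [hdim]
    exact Nat.find_min' hex ⟨U', π', h, rfl⟩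
  have := hU.finite
  have hmul : ∀ g h u, U.ρ (g * h) u = U.ρ g (U.ρ h u) := fun g h u => by simp
  have hnorm : ∀ g u, ∀ k ∈ K, ∃ k' ∈ K, U.ρ k (U.ρ g u) = U.ρ g (U.ρ k' u) := fun g u k hk =>
    ⟨g⁻¹ * k * g, by simpa using Subgroup.Normal.conj_mem ‹_› k hk g⁻¹, by
      rw [← hmul, ← hmul]; congr 2; group⟩
  obtain ⟨u₁, hu₁⟩ : ∃ u, π u ≠ 0 := by
    by_contra! h
    exact hU.ne_zero (LinearMap.ext h)
  -- a minimal submodule of the kernel of the functional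
  obtain ⟨V, ⟨hV0, hVπ, hVinv⟩, hVmin⟩ := (wellFounded_lt (α := Submodule F U)).has_min
    {W | W ≠ ⊥ ∧ W ≤ LinearMap.ker π ∧ ∀ g, ∀ w ∈ W, U.ρ g w ∈ W} (by
      refine ⟨LinearMap.ker π, fun h => hu₁ (hU.vanish _ fun k _ => ?_), le_rfl, fun g w hw => ?_⟩
      · have : U.ρ k u₁ - u₁ ∈ LinearMap.ker π := by
          rw [LinearMap.mem_ker, map_sub, hU.invariant, sub_self]
        rw [h, Submodule.mem_bot] at this
        exact sub_eq_zero.1 this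
      · rw [LinearMap.mem_ker, hU.invariant]
        exact hw)
  have hVmin' : ∀ W : Submodule F U, W ≤ V → (∀ g, ∀ w ∈ W, U.ρ g w ∈ W) → W = ⊥ ∨ W = V := by
    intro W hW hWinv
    refine or_iff_not_imp_left.2 fun h0 => ?_
    by_contra hne
    exact hVmin W ⟨h0, hW.trans hVπ, hWinv⟩ (lt_of_le_of_ne hW hne)
  -- the subgroup acts trivially modulo `V`
  obtain ⟨u₂, hu₂, hu₂'⟩ : ∃ u, (∀ k ∈ K, U.ρ k u - u ∈ V) ∧ π u ≠ 0 := by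
    by_contra! hno
    have hle : ∀ g, V ≤ V.comap (U.ρ g) := fun g w hw => hVinv g w hw
    have h1 : HasNonsplitFunctional K (Rep.quotient U V hle) (V.liftQ π hVπ) := by
      refine ⟨inferInstanceAs (FiniteDimensional F (U ⧸ V)), fun g u => ?_, fun h => ?_,
        fun u hu => ?_⟩
      · obtain ⟨u, rfl⟩ := Submodule.Quotient.mk_surjective _ u
        exact hU.invariant g u
      · refine hu₁ ?_
        exact LinearMap.congr_fun h (Submodule.Quotient.mk u₁)
      · obtain ⟨u, rfl⟩ := Submodule.Quotient.mk_surjective _ u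
        refine hno u fun k hk => ?_
        exact (Submodule.Quotient.eq _).1 (hu k hk)
    have h2 := hmin _ _ h1
    have h3 := Submodule.finrank_quotient_add_finrank V
    have h4 : Module.finrank F V ≠ 0 := fun h => hV0 (Submodule.finrank_eq_zero.1 h)
    change Module.finrank F U ≤ Module.finrank F (U ⧸ V) at h2
    omega
  have hUV : ∀ u, ∀ k ∈ K, U.ρ k u - u ∈ V := by
    let U' : Submodule F U :=
      { carrier := {u | ∀ k ∈ K, U.ρ k u - u ∈ V}
        add_mem' := fun {a b} ha hb k hk => by
          rw [map_add, add_sub_add_comm]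
          exact V.add_mem (ha k hk) (hb k hk)
        zero_mem' := fun k _ => by simp
        smul_mem' := fun c a ha k hk => by
          rw [map_smul, ← smul_sub]
          exact V.smul_mem c (ha k hk) }
    have hle : ∀ g, U' ≤ U'.comap (U.ρ g) := fun g u hu k hk => by
      obtain ⟨k', hk', e⟩ := hnorm g u k hk
      rw [e, ← map_sub]
      exact hVinv g _ (hu k' hk')
    have h1 : HasNonsplitFunctional K (Rep.subrepresentation U U' hle) (π ∘ₗ U'.subtype) := by
      refine ⟨inferInstanceAs (FiniteDimensional F U'), fun g u => hU.invariant g u, fun h => ?_,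
        fun u hu => hU.vanish u fun k hk => congrArg Subtype.val (hu k hk)⟩
      exact hu₂' (LinearMap.congr_fun h ⟨u₂, hu₂⟩)
    have h2 := hmin _ _ h1
    have h3 : U' = ⊤ := Submodule.eq_top_of_finrank_eq (le_antisymm (Submodule.finrank_le _) h2)
    intro u
    have : u ∈ U' := h3 ▸ Submodule.mem_top
    exact this
  -- the invariants of the subgroup
  let T : Submodule F U :=
    { carrier := {u | ∀ k ∈ K, U.ρ k u = u}
      add_mem' := fun {a b} ha hb k hk => by rw [map_add, ha k hk, hb k hk]
      zero_mem' := fun k _ => by simp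
      smul_mem' := fun c a ha k hk => by rw [map_smul, ha k hk] }
  have hTinv : ∀ g, ∀ u ∈ T, U.ρ g u ∈ T := fun g u hu k hk => by
    obtain ⟨k', hk', e⟩ := hnorm g u k hk
    rw [e, hu k' hk']
  have hTπ : T ≤ LinearMap.ker π := fun u hu => hU.vanish u hu
  -- If the differences `k u - u` are themselves `K`-fixed, they depend additively on `k`, so they
  -- vanish by `hperf`.
  have hcocycle : ∀ u, ∀ W ≤ T, (∀ k ∈ K, U.ρ k u - u ∈ W) → u ∈ T := by
    intro u W hWT hW k hk
    have := hperf W (fun k => ⟨U.ρ k u - u, hW k k.2⟩) (fun a b => Subtype.ext (by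
      have h1 := hWT (hW b b.2) a a.2
      rw [map_sub] at h1
      change U.ρ (a * b : G) u - u = (U.ρ a u - u) + (U.ρ b u - u)
      rw [hmul, ← h1]
      abel)) ⟨k, hk⟩
    exact sub_eq_zero.1 (congrArg Subtype.val this)
  have hVT : ¬ V ≤ T := fun hle => hu₁ (hTπ (hcocycle u₁ V hle (hUV u₁)))
  have hdisj : V ⊓ T = ⊥ := by
    refine (hVmin' (V ⊓ T) inf_le_left fun g w hw => ⟨hVinv g w hw.1, hTinv g w hw.2⟩).resolve_right
      fun h => hVT (inf_eq_left.1 h)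
  have huniq : ∀ a ∈ V, ∀ b ∈ T, ∀ c ∈ V, ∀ d ∈ T, a + b = c + d → a = c := by
    intro a ha b hb c hc d hd e
    have h1 : a - c = d - b := by rw [sub_eq_sub_iff_add_eq_add, e, add_comm]
    have h2 : a - c ∈ V ⊓ T := ⟨V.sub_mem ha hc, h1 ▸ T.sub_mem hd hb⟩
    rw [hdisj, Submodule.mem_bot] at h2
    exact sub_eq_zero.1 h2
  have hVTinv : ∀ g, ∀ w ∈ V ⊔ T, U.ρ g w ∈ V ⊔ T := fun g w hw => by
    obtain ⟨a, ha, b, hb, rfl⟩ := Submodule.mem_sup.1 hw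
    rw [map_add]
    exact Submodule.add_mem_sup (hVinv g a ha) (hTinv g b hb)
  have hu₁' : u₁ ∉ V ⊔ T := fun h => hu₁ ((sup_le hVπ hTπ) h)
  -- a vector which is invariant modulo `V ⊔ T`
  obtain ⟨u, hu, hinv⟩ : ∃ u, u ∉ V ⊔ T ∧ ∀ g, U.ρ g u - u ∈ V ⊔ T := by
    have hKtop : K ≠ ⊤ := fun h => hp.one_lt.ne' (by rw [← hindex, h, Subgroup.index_top])
    obtain ⟨x, hx⟩ : ∃ x, x ∉ K := by
      by_contra! h
      exact hKtop ((Subgroup.eq_top_iff' K).2 h)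
    -- In characteristic `p` one has `D ^ p = x ^ p - 1`, and `x ^ p ∈ K` acts trivially modulo `V`.
    -- The last iterate of `u₁` under `D` outside `V ⊔ T` is therefore fixed by `x` and by `K`
    -- modulo `V ⊔ T`, and these generate `G` because `K` has prime index.
    let D : Module.End F U := U.ρ x - 1
    have hDp : (D ^ p) u₁ ∈ V ⊔ T := by
      have : Nontrivial U := ⟨u₁, 0, fun h => hu₁ (by rw [h, map_zero])⟩
      have : CharP (Module.End F U) p := charP_of_injective_algebraMap
        (FaithfulSMul.algebraMap_injective F (Module.End F U)) p
      have : Fact p.Prime := ⟨hp⟩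
      have h1 : D ^ p = U.ρ (x ^ p) - 1 := by
        rw [sub_pow_char_of_commute _ (Commute.one_right _), one_pow, map_pow]
      rw [h1]
      exact Submodule.mem_sup_left (hUV u₁ _ (hindex ▸ K.pow_index_mem x))
    have hex' : ∃ j, (D ^ j) u₁ ∈ V ⊔ T := ⟨p, hDp⟩
    obtain ⟨j, hj⟩ : ∃ j, Nat.find hex' = j + 1 := Nat.exists_eq_succ_of_ne_zero fun h0 => by
      have := Nat.find_spec hex'
      rw [h0] at this
      exact hu₁' this
    have hj1 : (D ^ (j + 1)) u₁ ∈ V ⊔ T := hj ▸ Nat.find_spec hex'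
    refine ⟨(D ^ j) u₁, Nat.find_min hex' (by omega), ?_⟩
    set u := (D ^ j) u₁
    let H : Subgroup G :=
      { carrier := {g | U.ρ g u - u ∈ V ⊔ T}
        mul_mem' := fun {a b} ha hb => by
          have := (V ⊔ T).add_mem (hVTinv a _ hb) ha
          rw [map_sub, sub_add_sub_cancel, ← hmul] at this
          exact this
        one_mem' := by simp
        inv_mem' := fun {a} ha => by
          have := (V ⊔ T).neg_mem (hVTinv a⁻¹ _ ha)
          rw [map_sub, ← hmul] at this
          simpa using this }
    have hKH : K ≤ H := fun k hk => Submodule.mem_sup_left (hUV u k hk)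
    have hxH : x ∈ H := by
      change U.ρ x u - u ∈ V ⊔ T
      rw [pow_succ'] at hj1
      exact hj1
    have hHtop : H = ⊤ := by
      have h1 := Subgroup.relIndex_mul_index hKH
      rw [hindex] at h1
      rcases (Nat.dvd_prime hp).1 (Dvd.intro_left _ h1) with h2 | h2
      · exact Subgroup.index_eq_one.1 h2
      · have h3 : K.relIndex H = 1 := by
          rw [h2] at h1
          exact Nat.eq_of_mul_eq_mul_right hp.pos (h1.trans (one_mul p).symm)
        exact absurd (Subgroup.relIndex_eq_one.1 h3 hxH) hx
    intro g
    have : g ∈ H := hHtop ▸ Subgroup.mem_top g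
    exact this
  have hdec : ∀ g, ∃ c ∈ V, ∃ d ∈ T, c + d = U.ρ g u - u := fun g =>
    Submodule.mem_sup.1 (hinv g)
  choose c hcV d hdT hcd using hdec
  refine ⟨Rep.subrepresentation U V fun g w hw => hVinv g w hw, ?_, ?_, ?_⟩
  · refine (Representation.isIrreducible_iff_forall_submodule _).2
      ⟨Submodule.nontrivial_iff_ne_bot.2 hV0, fun W hW => ?_⟩
    refine (hVmin' (W.map V.subtype) (Submodule.map_subtype_le V W) ?_).imp (fun h => ?_) fun h => ?_
    · rintro g _ ⟨w, hw, rfl⟩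
      exact ⟨_, hW g w hw, rfl⟩
    · exact Submodule.map_injective_of_injective V.injective_subtype (h.trans (Submodule.map_bot _).symm)
    · refine Submodule.eq_top_iff'.2 fun w => ?_
      have h1 : (w : U) ∈ W.map V.subtype := by rw [h]; exact w.2
      obtain ⟨w', hw', e⟩ := h1
      rwa [← Subtype.ext e]
  · by_contra! h
    refine hVT fun v hv k hk => ?_
    exact congrArg Subtype.val (LinearMap.congr_fun (h k hk) ⟨v, hv⟩)
  · refine GroupCochain.nontrivial_groupCohomology_one _ (fun g => (⟨c g, hcV g⟩ : V))
      (fun g h => Subtype.ext ?_) fun a ha => hu ?_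
    · change c (g * h) = U.ρ g (c h) + c g
      refine huniq _ (hcV (g * h)) _ (hdT (g * h)) _ (V.add_mem (hVinv g _ (hcV h)) (hcV g)) _
        (T.add_mem (hTinv g _ (hdT h)) (hdT g)) ?_
      have h1 := hcd h
      have h2 := congrArg (U.ρ g) h1
      rw [map_add, map_sub, ← hmul] at h2
      rw [hcd, add_add_add_comm, hcd, h2]
      abel
    -- If `c` were principal, given by `a`, then `u - a` would be `K`-fixed modulo `T`, hence in
    -- `T`, which puts `u` into `V ⊔ T`.
    · have h1 : u - a.1 ∈ T := by
        refine hcocycle _ T le_rfl fun k hk => ?_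
        have h2 : c k = U.ρ k a.1 - a.1 := congrArg Subtype.val (ha k)
        have h3 : U.ρ k (u - a.1) - (u - a.1) = d k := by
          have := hcd k
          rw [map_sub, sub_sub_sub_comm, ← this, h2]
          abel
        rw [h3]
        exact hdT k
      have := Submodule.add_mem_sup a.2 h1
      rwa [add_sub_cancel] at this

end

/-! ### The structure of `L` between `S` and `Aut(S)` -/

namespace IsExtensionByOuterAut

variable {p : ℕ} {S : Type u} [Group S] {L : Subgroup (MulAut S)} (h : IsExtensionByOuterAut p S L)
include h

theorem finite_group : Finite L := by
  have := h.finite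
  have : Finite (MulAut S) := Finite.of_injective (fun φ : MulAut S => (φ : S → S))
    DFunLike.coe_injective
  infer_instance

omit h in
/-- The group of inner automorphisms as a subgroup of `L`. -/
abbrev inner (L : Subgroup (MulAut S)) : Subgroup L :=
  (MulAut.conj : S →* MulAut S).range.subgroupOf L

omit h in
theorem mul_conj_mul_inv (φ : MulAut S) (s : S) : φ * MulAut.conj s * φ⁻¹ = MulAut.conj (φ s) := by
  ext x
  simp [MulAut.inv_apply]

theorem center_eq_one {s : S} (hs : ∀ x, s * x = x * s) : s = 1 := by
  have := h.simple
  have h1 := (Subgroup.Normal.eq_bot_or_eq_top (H := Subgroup.center S) inferInstance)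
  rcases h1 with h1 | h1
  · have : s ∈ Subgroup.center S := Subgroup.mem_center_iff.2 fun g => (hs g).symm
    rwa [h1, Subgroup.mem_bot] at this
  · obtain ⟨a, b, hab⟩ := h.nonabelian
    have : a ∈ Subgroup.center S := h1 ▸ Subgroup.mem_top a
    exact absurd (Subgroup.mem_center_iff.1 this b).symm hab

theorem conj_injective : Function.Injective (MulAut.conj : S →* MulAut S) := by
  rw [injective_iff_map_eq_one]
  intro s hs
  refine h.center_eq_one fun x => ?_
  have := DFunLike.congr_fun hs x
  rw [MulAut.conj_apply, MulAut.one_apply] at this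
  exact mul_inv_eq_iff_eq_mul.1 this

omit h in
theorem normal_inner : (inner L).Normal := by
  refine ⟨?_⟩
  rintro ⟨_, _⟩ ⟨s, rfl⟩ ⟨φ, hφ⟩
  exact ⟨φ s, (mul_conj_mul_inv φ s).symm⟩

/-- The embedding of `S` into `L` by inner automorphisms. -/
def toInner : S →* L :=
  (MulAut.conj : S →* MulAut S).codRestrict L fun s => h.inn_le ⟨s, rfl⟩

theorem mem_inner_iff {g : L} : g ∈ inner L ↔ ∃ s, h.toInner s = g := by
  constructor
  · rintro ⟨s, hs⟩
    exact ⟨s, Subtype.ext hs⟩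
  · rintro ⟨s, rfl⟩
    exact ⟨s, rfl⟩

theorem toInner_injective : Function.Injective h.toInner := fun _ _ e =>
  h.conj_injective (congrArg Subtype.val e)

theorem card_inner : Nat.card (inner L) = Nat.card S := by
  have : inner L = h.toInner.range := by
    ext g
    exact h.mem_inner_iff
  rw [this]
  exact (Nat.card_congr (MonoidHom.ofInjective h.toInner_injective).toEquiv).symm

theorem nontrivial_group : Nontrivial L := by
  have := h.simple
  exact h.toInner_injective.nontrivial

theorem hom_eq_zero {T : Type*} [AddCommGroup T] (f : S → T) (hf : ∀ a b, f (a * b) = f a + f b)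
    (a : S) : f a = 0 := by
  have := h.simple
  let φ : S →* Multiplicative T := MonoidHom.mk' (fun s => Multiplicative.ofAdd (f s)) fun a b => by
    rw [hf, ofAdd_add]
  rcases Subgroup.Normal.eq_bot_or_eq_top (H := φ.ker) inferInstance with h1 | h1
  · obtain ⟨a, b, hab⟩ := h.nonabelian
    refine absurd ((MonoidHom.ker_eq_bot_iff φ).1 h1 ?_) hab
    rw [map_mul, map_mul, mul_comm]
  · have : a ∈ φ.ker := h1 ▸ Subgroup.mem_top a
    exact this

/-- The commutator of `g ∈ N` with the inner automorphism of `s` is the inner automorphism of `g(s)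
s⁻¹`. If `N` meets `S` trivially, this forces `g(s) = s` for all `s`. Applied to a kernel, it makes
every module on which `S` acts nontrivially faithful. -/
theorem eq_bot_or_inner_le (N : Subgroup L) [N.Normal] : N = ⊥ ∨ inner L ≤ N := by
  have := h.simple
  rcases Subgroup.Normal.eq_bot_or_eq_top (H := N.comap h.toInner) inferInstance with h1 | h1
  · left
    refine (Subgroup.eq_bot_iff_forall N).2 fun g hg => ?_
    refine Subtype.ext (MulEquiv.ext fun s => ?_)
    have hmem : (h.toInner (g.1 s * s⁻¹)) ∈ N := by
      have e : h.toInner (g.1 s * s⁻¹) = g * (h.toInner s * g⁻¹ * (h.toInner s)⁻¹) := by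
        refine Subtype.ext ?_
        change MulAut.conj (g.1 s * s⁻¹) = g.1 * (MulAut.conj s * g.1⁻¹ * (MulAut.conj s)⁻¹)
        rw [map_mul, map_inv, ← mul_conj_mul_inv]
        group
      rw [e]
      exact N.mul_mem hg (Subgroup.Normal.conj_mem ‹_› _ (N.inv_mem hg) _)
    have h2 : g.1 s * s⁻¹ ∈ N.comap h.toInner := hmem
    rw [h1, Subgroup.mem_bot, mul_inv_eq_one] at h2
    exact h2
  · right
    intro g hg
    obtain ⟨s, rfl⟩ := h.mem_inner_iff.1 hg
    have : s ∈ N.comap h.toInner := h1 ▸ Subgroup.mem_top s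
    exact this

theorem exists_character (hp : p.Prime) (F : Type*) [Field F] [CharP F p] :
    ∃ (χ : L →* Multiplicative F) (x : L), χ x = Multiplicative.ofAdd 1 := by
  have : (inner L).Normal := normal_inner
  exact exists_character_of_index_eq (inner L) hp h.index

/-- Over every field of characteristic `p` the group `L` has an irreducible faithful module with
nonzero first cohomology. -/
theorem exists_module (hp : p.Prime) (F : Type u) [Field F] [CharP F p] :
    ∃ V : Rep.{u} F L, IsIrreducibleFaithful V ∧ Nontrivial (groupCohomology V 1) := by
  have := h.finite_group
  have hn : (inner L).Normal := normal_inner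
  obtain ⟨V, hV, ⟨k, hk, hk1⟩, hH⟩ := exists_irreducible_of_nonsplit (F := F) (inner L) hp h.index
    (h.card_inner ▸ h.dvd_card) fun T _ f hf a => by
      have h1 : ∀ s, h.toInner s ∈ inner L := fun s => h.mem_inner_iff.2 ⟨s, rfl⟩
      obtain ⟨s, hs⟩ := h.mem_inner_iff.1 a.2
      have h2 := h.hom_eq_zero (fun s => f ⟨h.toInner s, h1 s⟩) (fun a b => by
        rw [← hf]
        congr 1
        exact Subtype.ext (map_mul _ _ _)) s
      rw [← h2]
      congr 1
      exact Subtype.ext hs.symm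
  refine ⟨V, ⟨hV, ?_⟩, hH⟩
  rcases h.eq_bot_or_inner_le V.ρ.ker with h1 | h1
  · exact (MonoidHom.ker_eq_bot_iff _).1 h1
  · exact absurd (h1 hk) hk1

end IsExtensionByOuterAut

/-! ### Field automorphisms of `SL_2` in characteristic two -/

open Matrix in
theorem isSimpleGroup_SL_two_of_charP_two (K : Type*) [Field K] [CharP K 2]
    (hK : 4 ≤ Nat.card K) : IsSimpleGroup (SpecialLinearGroup (Fin 2) K) := by
  have hc : Subgroup.center (SpecialLinearGroup (Fin 2) K) = ⊥ := by
    refine (Subgroup.eq_bot_iff_forall _).2 fun A hA => ?_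
    obtain ⟨r, hr, hrA⟩ := Matrix.SpecialLinearGroup.mem_center_iff.1 hA
    -- In characteristic two a scalar with `r ^ 2 = 1` satisfies `(r - 1) ^ 2 = 0`, so the centre is
    -- trivial and `SL_2 = PSL_2`.
    have hr1 : r = 1 := by
      rw [Fintype.card_fin] at hr
      have : (r - 1) ^ 2 = 0 := by
        rw [sub_pow_char, hr, one_pow, sub_self]
      exact sub_eq_zero.1 (pow_eq_zero_iff two_ne_zero |>.1 this)
    refine Subtype.ext ?_
    rw [← hrA, hr1, map_one]
    rfl
  have := Matrix.ProjectiveSpecialLinearGroup.rank_two_simple hK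
  exact ((QuotientGroup.quotientMulEquivOfEq hc).trans
    QuotientGroup.quotientBot).symm.isSimpleGroup

namespace FieldAut

open Matrix

variable {K : Type u} [Field K]

/-- The action of field automorphisms on the special linear group. -/
def toMulAut : RingAut K →* MulAut (SpecialLinearGroup (Fin 2) K) where
  toFun σ :=
    { SpecialLinearGroup.map (n := Fin 2) (σ : K →+* K) with
      invFun := SpecialLinearGroup.map (n := Fin 2) ((σ⁻¹ : RingAut K) : K →+* K)
      left_inv := fun A => by
        refine Subtype.ext (Matrix.ext fun i j => ?_)
        exact σ.symm_apply_apply _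
      right_inv := fun A => by
        refine Subtype.ext (Matrix.ext fun i j => ?_)
        exact σ.apply_symm_apply _ }
  map_one' := rfl
  map_mul' _ _ := rfl

theorem toMulAut_apply (σ : RingAut K) (A : SpecialLinearGroup (Fin 2) K) (i j : Fin 2) :
    (toMulAut σ A).1 i j = σ (A.1 i j) := rfl

theorem mul_val (A B : SpecialLinearGroup (Fin 2) K) (i j : Fin 2) :
    (A * B).1 i j = A.1 i 0 * B.1 0 j + A.1 i 1 * B.1 1 j := by
  change (A.1 * B.1) i j = _
  rw [Matrix.mul_apply, Fin.sum_univ_two]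

/-- An upper unitriangular matrix. -/
def upper (x : K) : SpecialLinearGroup (Fin 2) K := ⟨!![1, x; 0, 1], by simp⟩

/-- A lower unitriangular matrix. -/
def lower (x : K) : SpecialLinearGroup (Fin 2) K := ⟨!![1, 0; x, 1], by simp⟩

theorem toMulAut_upper (σ : RingAut K) (x : K) : toMulAut σ (upper x) = upper (σ x) := by
  refine Subtype.ext (Matrix.ext fun i j => ?_)
  rw [toMulAut_apply]
  fin_cases i <;> fin_cases j <;> simp [upper]

/-- If conjugation by `h` induced `σ`, comparing `h * upper 1 = upper 1 * h` would make `h` upper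
triangular with equal diagonal entries. Such an `h` commutes with every `upper x`, so `σ x = x`. -/
theorem toMulAut_notMem_range_conj {σ : RingAut K} (hσ : σ ≠ 1) :
    toMulAut σ ∉ (MulAut.conj : SpecialLinearGroup (Fin 2) K →* _).range := by
  rintro ⟨h, hh⟩
  refine hσ (RingEquiv.ext fun x => ?_)
  have key : ∀ x, h * upper x = upper (σ x) * h := fun x => by
    have := DFunLike.congr_fun hh (upper x)
    rw [MulAut.conj_apply, toMulAut_upper] at this
    exact mul_inv_eq_iff_eq_mul.1 this
  have key' : ∀ x, h.1 * (upper x).1 = (upper (σ x)).1 * h.1 := fun x =>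
    congrArg Subtype.val (key x)
  have h1 := key' 1
  rw [map_one] at h1
  have hdet := h.2
  rw [Matrix.det_fin_two] at hdet
  have e00 := congrFun (congrFun h1 0) 0
  have e01 := congrFun (congrFun h1 0) 1
  have f01 := congrFun (congrFun (key' x) 0) 1
  simp [upper, Matrix.mul_apply, Fin.sum_univ_two] at e00 e01 f01
  have hd : h.1 0 0 = h.1 1 1 := by
    have := e01
    rw [add_comm] at this
    exact add_left_cancel this
  rw [e00, mul_zero, sub_zero] at hdet
  have h0 : h.1 0 0 ≠ 0 := fun h0 => by simp [h0] at hdet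
  rw [← hd, add_comm, mul_comm (σ x)] at f01
  change σ x = x
  exact (mul_left_cancel₀ h0 (add_left_cancel f01)).symm

/-- A field automorphism of prime order `p` yields an extension of the special linear group of
degree two by an outer automorphism of order `p`. -/
theorem exists_isExtensionByOuterAut [CharP K 2] (hK : 4 ≤ Nat.card K) {p : ℕ} (hp : p.Prime)
    {σ : RingAut K} (hσ : σ ≠ 1) (hσp : σ ^ p = 1)
    (hdvd : p ∣ Nat.card (SpecialLinearGroup (Fin 2) K)) :
    ∃ L, IsExtensionByOuterAut p (SpecialLinearGroup (Fin 2) K) L := by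
  have : Finite K := (Nat.card_pos_iff.1 (by omega)).2
  set I := (MulAut.conj : SpecialLinearGroup (Fin 2) K →* _).range
  have hI : I.Normal := by
    refine ⟨?_⟩
    rintro _ ⟨s, rfl⟩ φ
    exact ⟨φ s, (IsExtensionByOuterAut.mul_conj_mul_inv φ s).symm⟩
  refine ⟨I ⊔ Subgroup.zpowers (toMulAut σ), inferInstance,
    isSimpleGroup_SL_two_of_charP_two K hK, ⟨upper 1, lower 1, fun h => ?_⟩, hdvd, le_sup_left, ?_⟩
  · have h1 := congrFun (congrFun (congrArg Subtype.val h) 0) 0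
    rw [mul_val, mul_val] at h1
    simp [upper, lower] at h1
  · rw [Subgroup.relIndex_sup_left]
    have h1 : I.relIndex (Subgroup.zpowers (toMulAut σ)) ∣ p := by
      refine (Subgroup.relIndex_dvd_card _ _).trans ?_
      rw [Nat.card_zpowers]
      refine orderOf_dvd_of_pow_eq_one ?_
      rw [← map_pow, hσp, map_one]
    refine ((Nat.dvd_prime hp).1 h1).resolve_left fun h2 => ?_
    exact toMulAut_notMem_range_conj hσ
      (Subgroup.relIndex_eq_one.1 h2 (Subgroup.mem_zpowers _))

/-- The diagonal torus. -/
def torus : Kˣ →* SpecialLinearGroup (Fin 2) K where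
  toFun a := ⟨!![(a : K), 0; 0, ((a⁻¹ : Kˣ) : K)], by simp⟩
  map_one' := by
    refine Subtype.ext (Matrix.ext fun i j => ?_)
    fin_cases i <;> fin_cases j <;> simp
  map_mul' a b := by
    refine Subtype.ext (Matrix.ext fun i j => ?_)
    refine Eq.trans ?_ (mul_val _ _ i j).symm
    fin_cases i <;> fin_cases j <;> simp [mul_comm]

theorem card_units_dvd_card : Nat.card Kˣ ∣ Nat.card (SpecialLinearGroup (Fin 2) K) :=
  Subgroup.card_dvd_of_injective torus fun a b h => Units.ext <| by
    exact congrFun (congrFun (congrArg Subtype.val h) 0) 0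

theorem two_dvd_card [CharP K 2] [Finite K] :
    2 ∣ Nat.card (SpecialLinearGroup (Fin 2) K) := by
  have h : orderOf (upper (1 : K)) = 2 := by
    refine orderOf_eq_prime ?_ fun h => ?_
    · refine Subtype.ext (Matrix.ext fun i j => ?_)
      rw [pow_two, mul_val]
      fin_cases i <;> fin_cases j <;> simp [upper, CharTwo.add_self_eq_zero]
    · simpa [upper] using congrFun (congrFun (congrArg Subtype.val h) 0) 1
  have h1 := orderOf_dvd_natCard (upper (1 : K))
  rwa [h] at h1

end FieldAut

/-- For every prime `p` there is a nonabelian finite simple group of order divisible by `p` with an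
outer automorphism of order `p`. -/
theorem exists_isExtensionByOuterAut (p : ℕ) (hp : p.Prime) :
    ∃ (S : Type u) (_ : Group S) (L : Subgroup (MulAut S)), IsExtensionByOuterAut p S L := by
  have hp2 := hp.two_le
  have hm : p * (p - 1) ≠ 0 := Nat.mul_ne_zero hp.ne_zero (by omega)
  -- The factor `p` in the exponent provides a field automorphism of order `p`. The factor `p - 1`
  -- gives `p ∣ 2 ^ (p * (p - 1)) - 1 = |Kˣ|` for odd `p` by Fermat. For `p = 2` the field has four
  -- elements and a unipotent element has order two.
  let K := ULift.{u} (GaloisField 2 (p * (p - 1)))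
  have hcard : Nat.card K = 2 ^ (p * (p - 1)) := by
    rw [Nat.card_ulift, GaloisField.card 2 _ hm]
  have hle : 2 ≤ p * (p - 1) := hp2.trans (Nat.le_mul_of_pos_right _ (by omega))
  have hK : 4 ≤ Nat.card K := hcard ▸ Nat.pow_le_pow_right (n := 2) two_pos hle
  have : Finite K := inferInstance
  have : Fintype K := Fintype.ofFinite K
  let σ : RingAut K := iterateFrobeniusEquiv K 2 (p - 1)
  have hσ : ∀ x, σ x = x ^ 2 ^ (p - 1) := fun x => by
    simp [σ, iterateFrobenius_def]
  have hσn : ∀ n x, (σ ^ n) x = x ^ 2 ^ (n * (p - 1)) := by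
    intro n
    induction n with
    | zero => simp
    | succ n ih =>
      intro x
      rw [pow_succ, RingAut.mul_apply, hσ, ih, ← pow_mul, ← pow_add, Nat.succ_mul, add_comm]
  refine ⟨_, _, FieldAut.exists_isExtensionByOuterAut (K := K) hK hp (σ := σ) ?_ ?_ ?_⟩
  -- A generator of `Kˣ` has order `|K| - 1`, too large to be fixed by `x ↦ x ^ 2 ^ (p - 1)`.
  · intro h
    obtain ⟨g, hg⟩ := IsCyclic.exists_generator (α := Kˣ)
    have h1 : g ^ 2 ^ (p - 1) = g := Units.ext <| by
      rw [Units.val_pow_eq_pow_val, ← hσ, h]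
      rfl
    have h2 : g ^ (2 ^ (p - 1) - 1) = 1 := by
      have h3 : 2 ^ (p - 1) = (2 ^ (p - 1) - 1) + 1 := (Nat.sub_add_cancel Nat.one_le_two_pow).symm
      rw [h3, pow_succ] at h1
      exact mul_eq_right.1 h1
    have h4 : 1 < 2 ^ (p - 1) := Nat.one_lt_two_pow (by omega)
    have h5 := orderOf_le_of_pow_eq_one (by omega) h2
    rw [orderOf_eq_card_of_forall_mem_zpowers hg, Nat.card_units, hcard] at h5
    have h6 : 2 ^ (p - 1) < 2 ^ (p * (p - 1)) :=
      Nat.pow_lt_pow_right one_lt_two (lt_mul_of_one_lt_left (by omega) hp.one_lt)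
    omega
  · refine RingEquiv.ext fun x => ?_
    rw [hσn, ← hcard, Nat.card_eq_fintype_card, FiniteField.pow_card]
    rfl
  · rcases hp.eq_two_or_odd' with rfl | hodd
    · exact FieldAut.two_dvd_card
    · refine dvd_trans ?_ FieldAut.card_units_dvd_card
      rw [Nat.card_units, hcard]
      have h1 : 2 ^ (p - 1) ≡ 1 [MOD p] := by
        have := Nat.ModEq.pow_totient ((Nat.coprime_primes Nat.prime_two hp).2 (by
          rintro rfl
          exact absurd hodd (by decide)))
        rwa [Nat.totient_prime hp] at this
      have h2 := h1.pow p
      rw [← pow_mul, one_pow, mul_comm] at h2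
      exact (Nat.modEq_iff_dvd' Nat.one_le_two_pow).1 h2.symm

/-! ### Numerical estimates and uniform lower bounds -/

/-- The falling factorial `j! * choose n j` is at least `(n + 1 - j) ^ j`, and `n + 1 - j ≥ (n + 1)
/ 2`. -/
theorem mul_pow_le_choose (j n : ℕ) (h : 2 * j ≤ n + 1) :
    1 / (2 ^ j * j.factorial : ℝ) * ((n + 1 : ℕ) : ℝ) ^ j ≤ (n.choose j : ℝ) := by
  have h1 : ((n + 1 - j : ℕ) : ℝ) ^ j ≤ j.factorial * n.choose j := by
    exact_mod_cast (Nat.pow_sub_le_descFactorial n j).trans_eq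
      (Nat.descFactorial_eq_factorial_mul_choose n j)
  have h2 : ((n + 1 : ℕ) : ℝ) / 2 ≤ ((n + 1 - j : ℕ) : ℝ) := by
    rw [Nat.cast_sub (by omega)]
    have : (2 * j : ℝ) ≤ ((n + 1 : ℕ) : ℝ) := by exact_mod_cast h
    linarith
  have h3 := (pow_le_pow_left₀ (by positivity) h2 j).trans h1
  rw [div_pow, div_le_iff₀ (by positivity)] at h3
  rw [one_div_mul_eq_div, div_le_iff₀ (by positivity)]
  linarith

/-- Once `m i ≥ 1`, the quotient is at least `e * m i ^ (k - 1 - j) ≥ e * m i`. -/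
theorem tendsto_div_pow_atTop {k j : ℕ} (hj : j + 2 ≤ k) {e : ℝ} (he : 0 < e) {m c : ℕ → ℕ}
    (hm : Tendsto m atTop atTop) (hc : ∀ i, e * (m i : ℝ) ^ (k - 1) ≤ c i) :
    Tendsto (fun i => (c i : ℝ) / (m i : ℝ) ^ j) atTop atTop := by
  have h1 : Tendsto (fun i => e * (m i : ℝ)) atTop atTop :=
    (tendsto_natCast_atTop_atTop.comp hm).const_mul_atTop he
  refine tendsto_atTop_mono' _ ?_ h1
  filter_upwards [hm.eventually_ge_atTop 1] with i hi
  have hi' : (1 : ℝ) ≤ m i := by exact_mod_cast hi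
  rw [le_div_iff₀ (by positivity), mul_assoc, ← pow_succ']
  exact (mul_le_mul_of_nonneg_left (pow_le_pow_right₀ hi' (by omega)) he.le).trans (hc i)

namespace IsExtensionByOuterAut

section

variable {p : ℕ} {F S : Type u} [Field F] [Group S] {L : Subgroup (MulAut S)}
  (h : IsExtensionByOuterAut p S L) {V : Rep.{u} F L} (hV : IsIrreducibleFaithful V)
include h hV

theorem isIrreducibleFaithful_and_dimRep (t : ℕ) (ht : 1 ≤ t) :
    IsIrreducibleFaithful (CyclicWreath.inducedModule V t) ∧
      dimRep (CyclicWreath.inducedModule V t) = t * dimRep (CyclicWreath.outerModule V t) := by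
  have : NeZero t := ⟨by omega⟩
  have := h.nontrivial_group
  exact ⟨CyclicWreath.isIrreducibleFaithful_inducedModule V t hV,
    CyclicWreath.dimRep_inducedModule V t⟩

theorem dimRep_pos : 0 < dimRep V := by
  have := h.finite_group
  have := hV.finiteDimensional
  have := hV.nontrivial
  exact Module.finrank_pos

end

section

variable {p : ℕ} (hp : p.Prime) {F S : Type u} [Field F] [CharP F p] [Group S]
  {L : Subgroup (MulAut S)} (h : IsExtensionByOuterAut p S L) {V : Rep.{u} F L}
  (hV : IsIrreducibleFaithful V) (hH : Nontrivial (groupCohomology V 1))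
include hp h hV hH

theorem mul_pow_le_dimCoh (j t : ℕ) (ht : 1 ≤ t) (htj : 2 * j ≤ t) :
    1 / (2 ^ j * j.factorial : ℝ) * (t : ℝ) ^ j ≤
      (dimCoh (j + 1) (CyclicWreath.inducedModule V t) : ℝ) := by
  obtain ⟨n, rfl⟩ : ∃ n, t = n + 1 := ⟨t - 1, by omega⟩
  have := h.finite_group
  have := hV.finiteDimensional
  obtain ⟨χ, x, hx⟩ := h.exists_character hp F
  refine (mul_pow_le_choose j n htj).trans ?_
  exact_mod_cast CyclicWreath.choose_le_dimCoh V χ x hx n j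

/-- The lower bound for the cohomology in terms of any upper bound for the dimension of `V`. -/
theorem mul_dimRep_pow_le_dimCoh {N : ℕ} (hN : dimRep V ≤ N) (j t : ℕ) (ht : 1 ≤ t)
    (htj : 2 * j ≤ t) :
    1 / (2 ^ j * j.factorial * N ^ j : ℝ) *
      (dimRep (CyclicWreath.inducedModule V t) : ℝ) ^ j ≤
      (dimCoh (j + 1) (CyclicWreath.inducedModule V t) : ℝ) := by
  refine le_trans ?_ (mul_pow_le_dimCoh hp h hV hH j t ht htj)
  have hpos := dimRep_pos h hV
  rw [(isIrreducibleFaithful_and_dimRep h hV t ht).2, Nat.cast_mul, mul_pow, one_div,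
    mul_inv, mul_assoc, one_div]
  refine mul_le_mul_of_nonneg_left ?_ (by positivity)
  rw [mul_comm, mul_assoc]
  refine mul_le_of_le_one_right (by positivity) ?_
  rw [← div_eq_mul_inv]
  refine div_le_one_of_le₀ ?_ (by positivity)
  exact pow_le_pow_left₀ (by positivity) (by exact_mod_cast hN) j

end

end IsExtensionByOuterAut

/-- In every characteristic there are irreducible faithful modules with large cohomology, with a
constant which does not depend on the field. -/
theorem exists_inducedModule_dimCoh_ge (p : ℕ) (hp : p.Prime) (k : ℕ) (hk : 1 ≤ k) :
    ∃ e : ℝ, 0 < e ∧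
    ∀ (F : Type u) [Field F] [IsAlgClosed F] [CharP F p],
      ∃ (S : Type u) (_ : Group S) (L : Subgroup (MulAut S)) (V : Rep.{u} F L) (t : ℕ → ℕ),
        IsExtensionByOuterAut p S L ∧ IsIrreducibleFaithful V ∧
        Nontrivial (groupCohomology V 1) ∧ (∀ i, 1 ≤ t i) ∧
        (∀ i, IsIrreducibleFaithful (CyclicWreath.inducedModule V (t i))) ∧
        Tendsto (fun i => dimRep (CyclicWreath.inducedModule V (t i))) atTop atTop ∧
        (∀ i, e * (dimRep (CyclicWreath.inducedModule V (t i)) : ℝ) ^ (k - 1) ≤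
          (dimCoh k (CyclicWreath.inducedModule V (t i)) : ℝ)) ∧
        (3 ≤ k → Tendsto (fun i => (dimCoh k (CyclicWreath.inducedModule V (t i)) : ℝ) /
          (dimRep (CyclicWreath.inducedModule V (t i)) : ℝ)) atTop atTop) ∧
        (3 ≤ k → Tendsto (fun i => (dimCoh k (CyclicWreath.inducedModule V (t i)) : ℝ) /
          (dimRep (CyclicWreath.inducedModule V (t i)) : ℝ) ^ (k - 2)) atTop atTop) := by
  obtain ⟨S, hS, L, h⟩ := exists_isExtensionByOuterAut.{u} p hp
  have := h.finite_group
  have hN : 0 < Nat.card L := Nat.card_pos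
  -- `|L|` replaces `dim V`, because `V` depends on `F` whereas `L` is fixed by `p` alone.
  refine ⟨1 / (2 ^ (k - 1) * (k - 1).factorial * Nat.card L ^ (k - 1) : ℝ), by positivity, ?_⟩
  intro F _ _ _
  obtain ⟨V, hV, hH⟩ := h.exists_module hp F
  have hdim := IsExtensionByOuterAut.isIrreducibleFaithful_and_dimRep h hV
  -- The shift by `2 * k` makes the estimate valid for every index `i` rather than only eventually.
  have hbound := fun i : ℕ => IsExtensionByOuterAut.mul_dimRep_pow_le_dimCoh hp h hV hH
    hV.dimRep_le (k - 1) (i + 2 * k) (by omega) (by omega)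
  rw [Nat.sub_add_cancel hk] at hbound
  have htend : Tendsto (fun i => dimRep (CyclicWreath.inducedModule V (i + 2 * k))) atTop atTop := by
    refine tendsto_atTop_mono (fun i => ?_) tendsto_id
    rw [(hdim _ (by omega)).2]
    exact (Nat.le_add_right i (2 * k)).trans
      (Nat.le_mul_of_pos_right _ (IsExtensionByOuterAut.dimRep_pos h hV))
  refine ⟨S, hS, L, V, fun i => i + 2 * k, h, hV, hH, fun i => by dsimp only; omega,
    fun i => (hdim (i + 2 * k) (by omega)).1, htend, hbound, fun hk3 => ?_, fun hk3 => ?_⟩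
  · simpa only [pow_one] using
      tendsto_div_pow_atTop (k := k) (j := 1) hk3 (by positivity) htend hbound
  · exact tendsto_div_pow_atTop (k := k) (by omega) (by positivity) htend hbound

end

/-! ### Assembly of the four assertions -/

theorem theoremG (p : ℕ) (hp : p.Prime) :
    -- the modules `M = X_N^G` for `G = L ≀ C_t`
    (∀ (F : Type u) [Field F] [IsAlgClosed F] [CharP F p] (S : Type u) [Group S]
        (L : Subgroup (MulAut S)), IsExtensionByOuterAut p S L →
      ∀ V : Rep.{u} F L, IsIrreducibleFaithful V → Nontrivial (groupCohomology V 1) →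
        (∀ t : ℕ, 1 ≤ t →
          IsIrreducibleFaithful (CyclicWreath.inducedModule V t) ∧
          dimRep (CyclicWreath.inducedModule V t) =
            t * dimRep (CyclicWreath.outerModule V t)) ∧
        (∀ k : ℕ, 2 ≤ k → ∃ d : ℝ, 0 < d ∧ ∀ᶠ t : ℕ in atTop,
          d * (t : ℝ) ^ (k - 2) * (dimRep (CyclicWreath.inducedModule V t) : ℝ) ≤
            (dimCoh k (CyclicWreath.inducedModule V t) : ℝ)) ∧
        (∀ k : ℕ, 1 ≤ k → ∃ e : ℝ, 0 < e ∧ ∀ᶠ t : ℕ in atTop,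
          e * (dimRep (CyclicWreath.inducedModule V t) : ℝ) ^ (k - 1) ≤
            (dimCoh k (CyclicWreath.inducedModule V t) : ℝ))) ∧
    -- such modules exist in every characteristic, with constants depending only on `k` and `p`
    (∀ k : ℕ, 1 ≤ k → ∃ e : ℝ, 0 < e ∧
      ∀ (F : Type u) [Field F] [IsAlgClosed F] [CharP F p],
        ∃ (S : Type u) (_ : Group S) (L : Subgroup (MulAut S)) (V : Rep.{u} F L) (t : ℕ → ℕ),
          IsExtensionByOuterAut p S L ∧ IsIrreducibleFaithful V ∧
          Nontrivial (groupCohomology V 1) ∧ (∀ i, 1 ≤ t i) ∧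
          (∀ i, IsIrreducibleFaithful (CyclicWreath.inducedModule V (t i))) ∧
          Tendsto (fun i => dimRep (CyclicWreath.inducedModule V (t i))) atTop atTop ∧
          (∀ i, e * (dimRep (CyclicWreath.inducedModule V (t i)) : ℝ) ^ (k - 1) ≤
            (dimCoh k (CyclicWreath.inducedModule V (t i)) : ℝ)) ∧
          (3 ≤ k → Tendsto (fun i => (dimCoh k (CyclicWreath.inducedModule V (t i)) : ℝ) /
            (dimRep (CyclicWreath.inducedModule V (t i)) : ℝ)) atTop atTop) ∧
          (3 ≤ k → Tendsto (fun i => (dimCoh k (CyclicWreath.inducedModule V (t i)) : ℝ) /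
            (dimRep (CyclicWreath.inducedModule V (t i)) : ℝ) ^ (k - 2)) atTop atTop)) ∧
    -- the resulting linear lower bound for second cohomology
    (∃ e : ℝ, 0 < e ∧ ∀ (F : Type u) [Field F] [IsAlgClosed F] [CharP F p] (d : ℕ),
      ∃ (G : Type u) (_ : Group G) (_ : Finite G) (M : Rep.{u} F G),
        IsIrreducibleFaithful M ∧ e * (dimRep M : ℝ) ≤ (dimCoh 2 M : ℝ) ∧ d < dimRep M) ∧
    -- the resulting unboundedness in degrees at least three
    (∀ k : ℕ, 3 ≤ k → ∀ (F : Type u) [Field F] [IsAlgClosed F] [CharP F p] (C : ℝ),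
      ∃ (G : Type u) (_ : Group G) (_ : Finite G) (M : Rep.{u} F G),
        IsIrreducibleFaithful M ∧ C < (dimCoh k M : ℝ) / (dimRep M : ℝ) ^ (k - 2)) := by
  have hB := exists_inducedModule_dimCoh_ge.{u} p hp
  refine ⟨?_, hB, ?_, ?_⟩
  · intro F _ _ _ S _ L h V hV hH
    have hD : 0 < dimRep V := IsExtensionByOuterAut.dimRep_pos h hV
    have hdim := IsExtensionByOuterAut.isIrreducibleFaithful_and_dimRep h hV
    refine ⟨hdim, fun k hk => ?_, fun k hk => ?_⟩
    -- Since `dim M = t * dim V`, the bound `t ^ (k - 1)` equals `t ^ (k - 2) * dim M / dim V`.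
    · refine ⟨1 / (2 ^ (k - 1) * (k - 1).factorial : ℝ) / dimRep V, by positivity, ?_⟩
      filter_upwards [eventually_ge_atTop (2 * k)] with t ht
      have h1 := IsExtensionByOuterAut.mul_pow_le_dimCoh hp h hV hH (k - 1) t (by omega) (by omega)
      rw [Nat.sub_add_cancel (by omega)] at h1
      refine le_of_eq_of_le ?_ h1
      have h2 : dimRep (CyclicWreath.outerModule V t) = dimRep V := rfl
      have h3 : k - 1 = k - 2 + 1 := by omega
      rw [(hdim t (by omega)).2, h2, Nat.cast_mul, h3]
      field_simp
      ring
    · refine ⟨1 / (2 ^ (k - 1) * (k - 1).factorial * dimRep V ^ (k - 1) : ℝ), by positivity, ?_⟩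
      filter_upwards [eventually_ge_atTop (2 * k)] with t ht
      have h1 := IsExtensionByOuterAut.mul_dimRep_pow_le_dimCoh hp h hV hH le_rfl (k - 1) t
        (by omega) (by omega)
      rwa [Nat.sub_add_cancel hk] at h1
  · obtain ⟨e, he, h⟩ := hB 2 one_le_two
    refine ⟨e, he, fun F _ _ _ d => ?_⟩
    obtain ⟨S, _, L, V, t, hL, -, -, ht, hM, htend, hbound, -⟩ := h F
    obtain ⟨i, hi⟩ := (htend.eventually_gt_atTop d).exists
    have : NeZero (t i) := ⟨Nat.one_le_iff_ne_zero.1 (ht i)⟩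
    have := hL.finite_group
    refine ⟨CyclicWreath L (t i), inferInstance, inferInstance, _, hM i, ?_, hi⟩
    simpa using hbound i
  · intro k hk F _ _ _ C
    obtain ⟨e, he, h⟩ := hB k (by omega)
    obtain ⟨S, _, L, V, t, hL, -, -, ht, hM, -, -, -, hlim⟩ := h F
    obtain ⟨i, hi⟩ := ((hlim hk).eventually_gt_atTop C).exists
    have : NeZero (t i) := ⟨Nat.one_le_iff_ne_zero.1 (ht i)⟩
    have := hL.finite_group
    exact ⟨CyclicWreath L (t i), inferInstance, inferInstance, _, hM i, hi⟩
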